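/- Let $K$ be a field of characteristic $0$. A Leibniz algebra over $K$ is a $K$-vector space with a bilinear product satisfying $[a,[b,c]]=[[a,b],c]-[[a,c],b]$; its nilradical is its largest nilpotent two-sided ideal. For $n\ge 1$ let $NF_n$ be the algebra with basis $e_1,\dots,e_n$ and nonzero products $[e_i,e_1]=e_{i+1}$, $1\le i\le n-1$. Let $k,s\ge 2$. On the vector space with basis $e_1,\dots,e_k,f_1,\dots,f_s,x$ define the following algebras (products of basis vectors that are not listed are zero). * For $\alpha\in K$, $\alpha\ne 0$, the algebra $R_{k,s}(\alpha)$: $$[e_i,e_1]=e_{i+1}\ (1\le i\le k-1),\quad [x,e_1]=e_1,\quad [e_i,x]=-i\,e_i\ (1\le i\le k),$$ $$[f_i,f_1]=f_{i+1}\ (1\le i\le s-1),\quad [x,f_1]=\alpha f_1,\quad [f_i,x]=-i\alpha f_i\ (1\le i\le s).$$ * For $\beta_2,\dots,\beta_s,\gamma\in K$, the algebra $R_{k,s}(\beta_2,\dots,\beta_s,\gamma)$: $$[e_i,e_1]=e_{i+1}\ (1\le i\le k-1),\quad [x,e_1]=e_1,\quad [e_i,x]=-i\,e_i\ (1\le i\le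 k),$$ $$[f_i,f_1]=f_{i+1}\ (1\le i\le s-1),\quad [f_i,x]=\sum_{j=i+1}^{s}\beta_{j-i+1}f_j\ (1\le i\le s),\quad [x,x]=\gamma f_s.$$ **Theorem.** 1. Let $R$ be a solvable Leibniz algebra over $K$ whose nilradical $N$ is isomorphic to $NF_k\oplus NF_s$ and has a one-dimensional complementary subspace $Q$, $R=N\oplus Q$. Then, up to interchanging the roles of $k$ and $s$ (that is, of the two summands) in the second family, $R$ is isomorphic to one of these algebras: $R\cong R_{k,s}(\alpha)$ for some $\alpha\neq 0$, or $R\cong R_{k,s}(\beta_2,\dots,\beta_s,\gamma)$ for some parameters, or $R\cong R_{s,k}(\beta_2,\dots,\beta_k,\gamma)$ for some parameters. If $K$ is algebraically closed, the parameters in the last two cases can be chosen such that the first nonzero entry of $(\beta_2,\dots,\beta_s,\gamma)$ (respectively of $(\beta_2,\dots,\beta_k,\gamma)$), if there is one, equals $1$. 2. Algebras of different types are not isomorphic: no $R_{k,s}(\alpha)$ with $\alpha\ne0$ is isomorphic to an algebra $R_{k,s}(\beta_2,\dots,\beta_s,\gamma)$ or $R_{s,k}(\beta_2,\dots,\beta_k,\gamma)$,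 and, if $k\neq s$, no $R_{k,s}(\beta_2,\dots,\beta_s,\gamma)$ is isomorphic to an $R_{s,k}(\beta'_2,\dots,\beta'_k,\gamma')$. 3. For $\alpha,\alpha'\ne0$: $R_{k,s}(\alpha)\cong R_{k,s}(\alpha')$ if and only if $\alpha=\alpha'$, or $k=s$ and $\alpha\alpha'=1$. 4. $R_{k,s}(\beta_2,\dots,\beta_s,\gamma)\cong R_{k,s}(\beta'_2,\dots,\beta'_s,\gamma')$ if and only if there is $A\in K$, $A\neq0$, such that $\beta_i=A^{i-1}\beta'_i$ for $2\le i\le s$ and $\gamma=A^s\gamma'$; the same holds with $k$ and $s$ interchanged. -/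

import Mathlib

namespace LeibnizAlg

noncomputable section

/-- A (not necessarily associative) algebra structure on the vector space `L`: a bilinear product
`[a, b] = μ a b`. -/
abbrev Product (K L : Type*) [Field K] [AddCommGroup L] [Module K L] := L →ₗ[K] L →ₗ[K] L

section General

variable {K L M : Type*} [Field K] [AddCommGroup L] [Module K L] [AddCommGroup M] [Module K M]

/-- The (right) Leibniz identity `[a, [b, c]] = [[a, b], c] - [[a, c], b]`. -/
def IsLeibniz (μ : Product K L) : Prop :=
  ∀ a b c : L, μ a (μ b c) = μ (μ a b) c - μ (μ a c) b

/-- `I` is a two-sided ideal. -/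
def IsIdeal (μ : Product K L) (I : Submodule K L) : Prop :=
  ∀ a : L, ∀ h ∈ I, μ a h ∈ I ∧ μ h a ∈ I

/-- `[H, J]`: the span of all products `[h, j]` and `[j, h]` with `h ∈ H`, `j ∈ J`. -/
def commutator (μ : Product K L) (H J : Submodule K L) : Submodule K L :=
  Submodule.map₂ μ H J ⊔ Submodule.map₂ μ J H

/-- The lower central series of the subalgebra `I`, with indices starting from zero:
`I, [I, I], [[I, I], I], …`. -/
def lowerCentral (μ : Product K L) (I : Submodule K L) : ℕ → Submodule K L
  | 0 => I
  | n + 1 => commutator μ (lowerCentral μ I n) I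

/-- The derived series of the algebra, with indices starting from zero. -/
def derivedSeries (μ : Product K L) : ℕ → Submodule K L
  | 0 => ⊤
  | n + 1 => commutator μ (derivedSeries μ n) (derivedSeries μ n)

/-- The subalgebra `I`, as an algebra of its own, is nilpotent. -/
def IsNilpotentSub (μ : Product K L) (I : Submodule K L) : Prop :=
  ∃ n : ℕ, lowerCentral μ I n = ⊥

/-- The algebra is solvable. -/
def IsSolvableAlg (μ : Product K L) : Prop :=
  ∃ n : ℕ, derivedSeries μ n = ⊥

/-- `N` is the nilradical: the largest nilpotent two-sided ideal. -/
def IsNilradical (μ : Product K L) (N : Submodule K L) : Prop :=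
  IsIdeal μ N ∧ IsNilpotentSub μ N ∧
    ∀ I : Submodule K L, IsIdeal μ I → IsNilpotentSub μ I → I ≤ N

/-- Isomorphism of algebras. -/
def Isomorphic (μ : Product K L) (ν : Product K M) : Prop :=
  ∃ φ : L ≃ₗ[K] M, ∀ a b : L, φ (μ a b) = ν (φ a) (φ b)

/-- The subspace `N` is a subalgebra of `(L, μ)` that, with the restricted product, is isomorphic
to the algebra `(M, ν)`: there is an injective homomorphism from `(M, ν)` with image `N`. -/
def SubIsomorphic (μ : Product K L) (N : Submodule K L) (ν : Product K M) : Prop :=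
  ∃ ψ : M →ₗ[K] L, Function.Injective ψ ∧ LinearMap.range ψ = N ∧
    ∀ u v : M, ψ (ν u v) = μ (ψ u) (ψ v)

/-- The direct sum of two algebras. -/
def directSum (μ : Product K L) (ν : Product K M) : Product K (L × M) :=
  LinearMap.mk₂ K (fun u v => (μ u.1 v.1, ν u.2 v.2))
    (by intro a b c; simp) (by intro r a b; simp) (by intro a b c; simp) (by intro r a b; simp)

end General

/-- The algebra with basis indexed by `ι` in which the product of the basis vectors number
`i` and `j` is `t i j`. -/
def ofTable {K ι : Type*} [Field K] [Finite ι] (t : ι → ι → (ι → K)) : Product K (ι → K) :=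
  (Pi.basisFun K ι).constr K fun i => (Pi.basisFun K ι).constr K (t i)

theorem ofTable_basis {K ι : Type*} [Field K] [Finite ι] (t : ι → ι → (ι → K)) (i j : ι) :
    ofTable t (Pi.basisFun K ι i) (Pi.basisFun K ι j) = t i j := by
  simp only [ofTable, Module.Basis.constr_basis]

/-- The null-filiform algebra of dimension `n`: basis `e_1, …, e_n`, nonzero products
`[e_i, e_1] = e_{i+1}` for `1 ≤ i ≤ n - 1`. The element `i : Fin n` is the index of
`e_{i+1}`. -/
def NF (K : Type*) [Field K] (n : ℕ) : Product K (Fin n → K) :=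
  ofTable fun i j => if j.val = 0 then (fun m => if m.val = i.val + 1 then 1 else 0) else 0

/-- Labels of the basis `e_1, …, e_k, f_1, …, f_s, x`: `e i` stands for `e_{i+1}` and `f i` for
`f_{i+1}`. -/
inductive Idx (k s : ℕ) : Type
  | e : Fin k → Idx k s
  | f : Fin s → Idx k s
  | x : Idx k s

instance (k s : ℕ) : Finite (Idx k s) :=
  Finite.of_injective
    (fun p : Idx k s => (match p with
      | .e i => Sum.inl i
      | .f i => Sum.inr (some i)
      | .x => Sum.inr none : Fin k ⊕ Option (Fin s)))
    (by intro p q h; cases p <;> cases q <;> simp_all)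

/-- The vector `e_m`, for `1 ≤ m ≤ k` (and zero for all other `m`). -/
def eVec (K : Type*) [Field K] (k s : ℕ) (m : ℕ) : Idx k s → K
  | .e i => if i.val + 1 = m then 1 else 0
  | .f _ => 0
  | .x => 0

/-- The vector `f_m`, for `1 ≤ m ≤ s` (and zero for all other `m`). -/
def fVec (K : Type*) [Field K] (k s : ℕ) (m : ℕ) : Idx k s → K
  | .e _ => 0
  | .f i => if i.val + 1 = m then 1 else 0
  | .x => 0

/-- The algebra `R(α)` with basis `e_1, …, e_k, f_1, …, f_s, x` and nonzero products
`[e_i, e_1] = e_{i+1}`, `[x, e_1] = e_1`, `[e_i, x] = -i e_i`,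
`[f_i, f_1] = f_{i+1}`, `[x, f_1] = α f_1`, `[f_i, x] = -i α f_i`. -/
def RDiag {K : Type*} [Field K] (k s : ℕ) (α : K) : Product K (Idx k s → K) :=
  ofTable fun p q => match p, q with
    | .e i, .e j => if j.val = 0 then eVec K k s (i.val + 2) else 0
    | .x, .e j => if j.val = 0 then eVec K k s 1 else 0
    | .e i, .x => (-((i.val + 1 : ℕ) : K)) • eVec K k s (i.val + 1)
    | .f i, .f j => if j.val = 0 then fVec K k s (i.val + 2) else 0
    | .x, .f j => if j.val = 0 then α • fVec K k s 1 else 0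
    | .f i, .x => (-((i.val + 1 : ℕ) : K) * α) • fVec K k s (i.val + 1)
    | _, _ => 0

/-- The algebra `R(β_2, …, β_s, γ)` with basis `e_1, …, e_k, f_1, …, f_s, x` and nonzero products
`[e_i, e_1] = e_{i+1}`, `[x, e_1] = e_1`, `[e_i, x] = -i e_i`,
`[f_i, f_1] = f_{i+1}`, `[f_i, x] = ∑_{j=i+1}^s β_{j-i+1} f_j`, `[x, x] = γ f_s`.
Only the values `β m` with `2 ≤ m ≤ s` are used. -/
def RNil {K : Type*} [Field K] (k s : ℕ) (β : ℕ → K) (γ : K) : Product K (Idx k s → K) :=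
  ofTable fun p q => match p, q with
    | .e i, .e j => if j.val = 0 then eVec K k s (i.val + 2) else 0
    | .x, .e j => if j.val = 0 then eVec K k s 1 else 0
    | .e i, .x => (-((i.val + 1 : ℕ) : K)) • eVec K k s (i.val + 1)
    | .f i, .f j => if j.val = 0 then fVec K k s (i.val + 2) else 0
    | .f i, .x => ∑ j ∈ Finset.Icc (i.val + 2) s, β (j - (i.val + 1) + 1) • fVec K k s j
    | .x, .x => γ • fVec K k s s
    | _, _ => 0

/-- The first nonzero entry of `(β_2, …, β_s, γ)`, if there is one, equals `1`. -/
def FirstNonzeroIsOne {K : Type*} [Field K] (s : ℕ) (β : ℕ → K) (γ : K) : Prop :=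
  (∀ i : ℕ, 2 ≤ i → i ≤ s → (∀ j : ℕ, 2 ≤ j → j < i → β j = 0) → β i ≠ 0 → β i = 1) ∧
  ((∀ j : ℕ, 2 ≤ j → j ≤ s → β j = 0) → γ ≠ 0 → γ = 1)

end

end LeibnizAlg

/-! Classification. The Leibniz identity makes squares and symmetrised products act as zero from the
right. Hence `e_j` and `f_j` with j ≥ 2 annihilate the whole algebra from the right (`mul_e_succ`),
and right multiplication by any x is a derivation of N, determined by its values on `e_1` and `f_1`.
Fix x outside N. Apart from a component of `[e_1, x]` along `f_s` and one of `[f_1, x]` along `e_k`,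
this derivation is triangular on each chain, with diagonal entries i·a on the first and i·b on the
second (`c_e_mul_self`). Left multiplication by x has leading coefficients -a and -b on the
generators (`c_mul_e`).

If a = b = 0, every product moves down the filtration by leading index, so R is nilpotent
(`isNilpotentSub_top`) and N could not be proper. Otherwise interchange the chains if necessary and
rescale x so that a = -1. In characteristic zero the e-part of `[x, x]` can be absorbed into x
(`exists_c_sq_eq_zero`), and then `[x, e_1]`, rather than `e_1`, generates a chain of exact
eigenvectors (`exists_isEigenchain`). If b ≠ 0, the same works for the second chain and gives the
first family with α = -b. If b = 0, x can be changed so that `[x, f_1] = 0` and `[x, x]` is a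
multiple of `f_s` (`exists_normalized`); correcting `f_1` by a multiple of `e_k` puts `[f_1, x]`
into the span of the `f_j`, and its coefficients are the β's.

Isomorphisms. The images of `e_1`, `f_1`, x are compared through their leading coordinates.
Vanishing mixed products and nonvanishing squares decide which generator goes to which chain, the
action of x gives the eigenvalues, and chain lengths distinguish k from s (`length_le_of_f`,
`length_le_of_e`). In the second family only a scaling of `f_1` survives, which gives the powers of
A. -/

namespace LeibnizAlg

noncomputable section

/-! ### Coordinate functionals and the product tables in coordinates. -/

section Coordinates

variable {K : Type*} [Field K] {k s : ℕ}

/-- The coefficient of `e_{i+1}`, zero for `i ≥ k`. -/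
def eCoord (K : Type*) [Field K] (k s i : ℕ) : (Idx k s → K) →ₗ[K] K :=
  if h : i < k then LinearMap.proj (Idx.e ⟨i, h⟩) else 0

/-- The coefficient of `f_{i+1}`, zero for `i ≥ s`. -/
def fCoord (K : Type*) [Field K] (k s i : ℕ) : (Idx k s → K) →ₗ[K] K :=
  if h : i < s then LinearMap.proj (Idx.f ⟨i, h⟩) else 0

/-- The coefficient of `x`. -/
def xCoord (K : Type*) [Field K] (k s : ℕ) : (Idx k s → K) →ₗ[K] K :=
  LinearMap.proj Idx.x

/-- The vector `x`. -/
def xVec (K : Type*) [Field K] (k s : ℕ) : Idx k s → K := Pi.basisFun K _ Idx.x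

@[simp] theorem basisFun_e (i : Fin k) :
    Pi.basisFun K (Idx k s) (Idx.e i) = eVec K k s (i.val + 1) := by
  classical
  funext p
  rcases p with j | j | _ <;> simp [Pi.basisFun_apply, Pi.single_apply, eVec, Fin.ext_iff]

@[simp] theorem basisFun_f (i : Fin s) :
    Pi.basisFun K (Idx k s) (Idx.f i) = fVec K k s (i.val + 1) := by
  classical
  funext p
  rcases p with j | j | _ <;> simp [Pi.basisFun_apply, Pi.single_apply, fVec, Fin.ext_iff]

theorem eVec_eq_zero {m : ℕ} (h : k < m) : eVec K k s m = 0 := by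
  funext p
  rcases p with j | j | _ <;> simp [eVec]
  omega

theorem fVec_eq_zero {m : ℕ} (h : s < m) : fVec K k s m = 0 := by
  funext p
  rcases p with j | j | _ <;> simp [fVec]
  omega

@[simp] theorem eCoord_eVec (i m : ℕ) :
    eCoord K k s i (eVec K k s m) = if i < k ∧ i + 1 = m then 1 else 0 := by
  unfold eCoord eVec
  split_ifs <;> simp_all

@[simp] theorem eCoord_fVec (i m : ℕ) : eCoord K k s i (fVec K k s m) = 0 := by
  unfold eCoord fVec
  split_ifs <;> simp

@[simp] theorem eCoord_xVec (i : ℕ) : eCoord K k s i (xVec K k s) = 0 := by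
  classical
  unfold eCoord xVec
  split_ifs <;> simp [Pi.basisFun_apply]

@[simp] theorem fCoord_fVec (i m : ℕ) :
    fCoord K k s i (fVec K k s m) = if i < s ∧ i + 1 = m then 1 else 0 := by
  unfold fCoord fVec
  split_ifs <;> simp_all

@[simp] theorem fCoord_eVec (i m : ℕ) : fCoord K k s i (eVec K k s m) = 0 := by
  unfold fCoord eVec
  split_ifs <;> simp

@[simp] theorem fCoord_xVec (i : ℕ) : fCoord K k s i (xVec K k s) = 0 := by
  classical
  unfold fCoord xVec
  split_ifs <;> simp [Pi.basisFun_apply]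

@[simp] theorem xCoord_eVec (m : ℕ) : xCoord K k s (eVec K k s m) = 0 := by
  simp [xCoord, eVec]

@[simp] theorem xCoord_fVec (m : ℕ) : xCoord K k s (fVec K k s m) = 0 := by
  simp [xCoord, fVec]

@[simp] theorem xCoord_xVec : xCoord K k s (xVec K k s) = 1 := by
  classical
  simp [xCoord, xVec, Pi.basisFun_apply]

theorem eCoord_of_le {i : ℕ} (h : k ≤ i) : eCoord K k s i = 0 := by
  simp [eCoord, Nat.not_lt.mpr h]

theorem fCoord_of_le {i : ℕ} (h : s ≤ i) : fCoord K k s i = 0 := by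
  simp [fCoord, Nat.not_lt.mpr h]

@[simp] theorem basisFun_x : Pi.basisFun K (Idx k s) Idx.x = xVec K k s := rfl

theorem coord_ext {v w : Idx k s → K} (he : ∀ i, eCoord K k s i v = eCoord K k s i w)
    (hf : ∀ i, fCoord K k s i v = fCoord K k s i w) (hx : xCoord K k s v = xCoord K k s w) :
    v = w := by
  funext p
  rcases p with j | j | _
  · simpa [eCoord] using he j
  · simpa [fCoord] using hf j
  · exact hx

/-- A coefficient of a product is a bilinear form in the factors, so a formula for it need only be
checked on pairs of basis vectors. -/
theorem ofTable_forms_eq (t : Idx k s → Idx k s → (Idx k s → K)) (F : (Idx k s → K) →ₗ[K] K)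
    (G : LinearMap.BilinForm K (Idx k s → K))
    (h : ∀ p q, F (t p q) = G (Pi.basisFun K _ p) (Pi.basisFun K _ q)) (a b : Idx k s → K) :
    F (ofTable t a b) = G a b := by
  have : (ofTable t).compr₂ F = G := by
    refine (Pi.basisFun K _).ext fun p => (Pi.basisFun K _).ext fun q => ?_
    rw [LinearMap.compr₂_apply, ofTable_basis, h]
  rw [← this, LinearMap.compr₂_apply]

open LinearMap.BilinForm

section RDiag

variable (α : K) (a b : Idx k s → K)

theorem xCoord_RDiag : xCoord K k s (RDiag k s α a b) = 0 := by
  refine (ofTable_forms_eq _ (xCoord K k s) 0 ?_ a b).trans (by simp)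
  rintro (i | i | _) (j | j | _) <;>
    simp [apply_ite (DFunLike.coe (xCoord K k s))]

theorem eCoord_RDiag_zero : eCoord K k s 0 (RDiag k s α a b) =
    (xCoord K k s a * eCoord K k s 0 b - eCoord K k s 0 a * xCoord K k s b) := by
  refine (ofTable_forms_eq _ (eCoord K k s 0)
    (linMulLin (xCoord K k s) (eCoord K k s 0) -
      linMulLin (eCoord K k s 0) (xCoord K k s))
    ?_ a b).trans (by simp)
  rintro (i | i | _) (j | j | _) <;>
    simp [apply_ite (DFunLike.coe (eCoord K k s 0))] <;>
    first | grind | (split_ifs with h <;> simp [h])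

theorem eCoord_RDiag_succ {m : ℕ} (hm : m + 1 < k) : eCoord K k s (m + 1) (RDiag k s α a b) =
    eCoord K k s m a * eCoord K k s 0 b -
    ((m + 2 : ℕ) : K) * (eCoord K k s (m + 1) a * xCoord K k s b) := by
  refine (ofTable_forms_eq _ (eCoord K k s (m + 1))
    (linMulLin (eCoord K k s m) (eCoord K k s 0) -
      ((m + 2 : ℕ) : K) • linMulLin (eCoord K k s (m + 1)) (xCoord K k s))
    ?_ a b).trans (by simp)
  rintro (i | i | _) (j | j | _) <;>
    simp [apply_ite (DFunLike.coe (eCoord K k s (m + 1)))] <;>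
    first | grind | (split_ifs with h <;> [(simp [← h.2]; ring); simp])

theorem fCoord_RDiag_zero : fCoord K k s 0 (RDiag k s α a b) =
    α * (xCoord K k s a * fCoord K k s 0 b - fCoord K k s 0 a * xCoord K k s b) := by
  refine (ofTable_forms_eq _ (fCoord K k s 0)
    (α • (linMulLin (xCoord K k s) (fCoord K k s 0) -
      linMulLin (fCoord K k s 0) (xCoord K k s)))
    ?_ a b).trans (by simp)
  rintro (i | i | _) (j | j | _) <;>
    simp [apply_ite (DFunLike.coe (fCoord K k s 0))] <;>
    first | grind | (split_ifs with h <;> simp [h])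

theorem fCoord_RDiag_succ {m : ℕ} (hm : m + 1 < s) : fCoord K k s (m + 1) (RDiag k s α a b) =
    fCoord K k s m a * fCoord K k s 0 b -
    ((m + 2 : ℕ) : K) * α * (fCoord K k s (m + 1) a * xCoord K k s b) := by
  refine (ofTable_forms_eq _ (fCoord K k s (m + 1))
    (linMulLin (fCoord K k s m) (fCoord K k s 0) -
      (((m + 2 : ℕ) : K) * α) • linMulLin (fCoord K k s (m + 1)) (xCoord K k s))
    ?_ a b).trans (by simp)
  rintro (i | i | _) (j | j | _) <;>
    simp [apply_ite (DFunLike.coe (fCoord K k s (m + 1)))] <;>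
    first | grind | (split_ifs with h <;> [(simp [← h.2]; ring); simp])

end RDiag

section RNil

variable (β : ℕ → K) (γ : K) (a b : Idx k s → K)

theorem xCoord_RNil : xCoord K k s (RNil k s β γ a b) = 0 := by
  refine (ofTable_forms_eq _ (xCoord K k s) 0 ?_ a b).trans (by simp)
  rintro (i | i | _) (j | j | _) <;>
    simp [apply_ite (DFunLike.coe (xCoord K k s))]

theorem eCoord_RNil_zero : eCoord K k s 0 (RNil k s β γ a b) =
    (xCoord K k s a * eCoord K k s 0 b - eCoord K k s 0 a * xCoord K k s b) := by
  refine (ofTable_forms_eq _ (eCoord K k s 0)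
    (linMulLin (xCoord K k s) (eCoord K k s 0) -
      linMulLin (eCoord K k s 0) (xCoord K k s))
    ?_ a b).trans (by simp)
  rintro (i | i | _) (j | j | _) <;>
    simp [apply_ite (DFunLike.coe (eCoord K k s 0))] <;>
    first | grind | (split_ifs with h <;> simp [h])

theorem eCoord_RNil_succ {m : ℕ} (hm : m + 1 < k) : eCoord K k s (m + 1) (RNil k s β γ a b) =
    eCoord K k s m a * eCoord K k s 0 b -
    ((m + 2 : ℕ) : K) * (eCoord K k s (m + 1) a * xCoord K k s b) := by
  refine (ofTable_forms_eq _ (eCoord K k s (m + 1))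
    (linMulLin (eCoord K k s m) (eCoord K k s 0) -
      ((m + 2 : ℕ) : K) • linMulLin (eCoord K k s (m + 1)) (xCoord K k s))
    ?_ a b).trans (by simp)
  rintro (i | i | _) (j | j | _) <;>
    simp [apply_ite (DFunLike.coe (eCoord K k s (m + 1)))] <;>
    first | grind | (split_ifs with h <;> [(simp [← h.2]; ring); simp])

theorem fCoord_RNil_zero (hs : 2 ≤ s) : fCoord K k s 0 (RNil k s β γ a b) = 0 := by
  refine (ofTable_forms_eq _ (fCoord K k s 0) 0 ?_ a b).trans (by simp)
  rintro (i | i | _) (j | j | _) <;> simp [apply_ite (DFunLike.coe (fCoord K k s 0))]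
  · exact Finset.sum_eq_zero fun j hj => if_neg (by grind)
  · grind

theorem fCoord_RNil_succ {m : ℕ} (hm : m + 1 < s) :
    fCoord K k s (m + 1) (RNil k s β γ a b) = fCoord K k s m a * fCoord K k s 0 b +
      ∑ l ∈ Finset.range (m + 1), β (l + 2) * (fCoord K k s (m - l) a * xCoord K k s b) +
      (if m + 2 = s then γ else 0) * (xCoord K k s a * xCoord K k s b) := by
  refine (ofTable_forms_eq _ (fCoord K k s (m + 1)) (linMulLin (fCoord K k s m) (fCoord K k s 0) +
    ∑ l ∈ Finset.range (m + 1), β (l + 2) • linMulLin (fCoord K k s (m - l)) (xCoord K k s) +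
    (if m + 2 = s then γ else 0) • linMulLin (xCoord K k s) (xCoord K k s)) ?_ a b).trans
      (by simp only [LinearMap.add_apply, LinearMap.sum_apply, LinearMap.smul_apply,
            linMulLin_apply, smul_eq_mul])
  rintro (i | i | _) (j | j | _) <;>
    simp only [LinearMap.add_apply, LinearMap.sum_apply, LinearMap.smul_apply, linMulLin_apply,
      smul_eq_mul]
  case f.x =>
    have h1 : ∀ j ∈ Finset.Icc (i.val + 2) s, j ≠ m + 2 →
        β (j - (i.val + 1) + 1) * (if m + 1 < s ∧ m + 1 + 1 = j then 1 else 0) = 0 := by grind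
    have h2 : ∀ l ∈ Finset.range (m + 1), l ≠ m - i.val →
        β (l + 2) * (if m - l < s ∧ m - l + 1 = i.val + 1 then 1 else 0) = 0 := by grind
    simp only [map_sum, map_smul, basisFun_f, basisFun_x, fCoord_fVec, fCoord_xVec, xCoord_xVec,
      xCoord_fVec, smul_eq_mul, mul_one, mul_zero, zero_add, add_zero]
    by_cases him : i.val ≤ m
    · rw [Finset.sum_eq_single (m + 2) h1 (by grind), Finset.sum_eq_single (m - i.val) h2 (by grind)]
      grind
    · rw [Finset.sum_eq_zero fun j hj => h1 j hj (by grind),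
        Finset.sum_eq_zero fun l hl => by grind]
  all_goals simp [apply_ite (DFunLike.coe (fCoord K k s (m + 1)))] <;> grind

end RNil

end Coordinates

/-! ### Invariants that separate the algebras in the list. -/

section Comparison

variable {K : Type*} [Field K] {k s : ℕ}

theorem Isomorphic.symm {L M : Type*} [AddCommGroup L] [Module K L] [AddCommGroup M] [Module K M]
    {μ : Product K L} {ν : Product K M} (h : Isomorphic μ ν) : Isomorphic ν μ := by
  obtain ⟨φ, hφ⟩ := h
  refine ⟨φ.symm, fun a b => φ.injective ?_⟩
  simp [hφ]

theorem Isomorphic.trans {L M P : Type*} [AddCommGroup L] [Module K L] [AddCommGroup M]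
    [Module K M] [AddCommGroup P] [Module K P] {μ : Product K L} {ν : Product K M}
    {π : Product K P} (h : Isomorphic μ ν) (h' : Isomorphic ν π) : Isomorphic μ π := by
  obtain ⟨φ, hφ⟩ := h
  obtain ⟨ψ, hψ⟩ := h'
  exact ⟨φ.trans ψ, fun a b => by simp [hφ, hψ]⟩

theorem eVec_ne_zero {m : ℕ} (h : m < k) : eVec K k s (m + 1) ≠ 0 := fun h0 => by
  simpa [h] using congrArg (eCoord K k s m) h0

theorem fVec_ne_zero {m : ℕ} (h : m < s) : fVec K k s (m + 1) ≠ 0 := fun h0 => by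
  simpa [h] using congrArg (fCoord K k s m) h0

/-- The features common to the product tables of both families: the coefficients of a product,
on the span of the `e_i` and `f_i`, arise by shifting. -/
structure IsShiftTable (ν : Product K (Idx k s → K)) : Prop where
  x_mul : ∀ a b, xCoord K k s (ν a b) = 0
  e_zero : ∀ a b, eCoord K k s 0 (ν a b) =
    xCoord K k s a * eCoord K k s 0 b - eCoord K k s 0 a * xCoord K k s b
  e_succ : ∀ m a b, m + 1 < k → xCoord K k s b = 0 →
    eCoord K k s (m + 1) (ν a b) = eCoord K k s m a * eCoord K k s 0 b
  f_zero : ∀ a b, xCoord K k s a = 0 → xCoord K k s b = 0 → fCoord K k s 0 (ν a b) = 0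
  f_succ : ∀ m a b, m + 1 < s → xCoord K k s b = 0 →
    fCoord K k s (m + 1) (ν a b) = fCoord K k s m a * fCoord K k s 0 b

theorem isShiftTable_RDiag (α : K) : IsShiftTable (RDiag k s α) where
  x_mul := xCoord_RDiag α
  e_zero := eCoord_RDiag_zero α
  e_succ m a b hm hb := by simp [eCoord_RDiag_succ α a b hm, hb]
  f_zero a b ha hb := by simp [fCoord_RDiag_zero, ha, hb]
  f_succ m a b hm hb := by simp [fCoord_RDiag_succ α a b hm, hb]

theorem isShiftTable_RNil (hs : 2 ≤ s) (β : ℕ → K) (γ : K) : IsShiftTable (RNil k s β γ) where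
  x_mul := xCoord_RNil β γ
  e_zero := eCoord_RNil_zero β γ
  e_succ m a b hm hb := by simp [eCoord_RNil_succ β γ a b hm, hb]
  f_zero a b ha hb := by simp [fCoord_RNil_zero β γ a b hs]
  f_succ m a b hm hb := by simp [fCoord_RNil_succ β γ a b hm, hb]

/-- Each multiplication by `U 0` shifts the `c`-coordinates by one place, while a single one already
kills all `d`-coordinates because `d 0 (U 0) = 0`. Abstract forms allow the two chains to be
exchanged; the alternative `= 0` covers indices beyond the end of a chain. -/
theorem chain_coords {V : Type*} [AddCommGroup V] [Module K V] {ν : Product K V}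
    {ξ : V →ₗ[K] K} {c d : ℕ → V →ₗ[K] K} (hξ : ∀ a b, ξ (ν a b) = 0)
    (hc0 : ∀ a b, ξ a = 0 → ξ b = 0 → c 0 (ν a b) = 0)
    (hc : ∀ m a b, ξ b = 0 → c (m + 1) (ν a b) = 0 ∨ c (m + 1) (ν a b) = c m a * c 0 b)
    (hd0 : ∀ a b, ξ a = 0 → ξ b = 0 → d 0 (ν a b) = 0)
    (hd : ∀ m a b, ξ b = 0 → d (m + 1) (ν a b) = 0 ∨ d (m + 1) (ν a b) = d m a * d 0 b)
    {n : ℕ} {U : ℕ → V} (hU : ∀ i, i + 1 < n → U (i + 1) = ν (U i) (U 0))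
    (hU0 : ξ (U 0) = 0) (hdU : d 0 (U 0) = 0) {i : ℕ} (hi : i < n) :
    ξ (U i) = 0 ∧ (∀ j < i, c j (U i) = 0) ∧ (1 ≤ i → ∀ j, d j (U i) = 0) := by
  induction i with
  | zero => exact ⟨hU0, by simp, by simp⟩
  | succ i ih =>
    obtain ⟨h1, h2, h3⟩ := ih (by omega)
    rw [hU i hi]
    refine ⟨hξ _ _, fun j hj => ?_, fun _ j => ?_⟩
    · rcases j with _ | j
      · exact hc0 _ _ h1 hU0
      · rcases hc j (U i) (U 0) hU0 with h | h
        · exact h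
        · rw [h, h2 j (by omega), zero_mul]
    · rcases j with _ | j
      · exact hd0 _ _ h1 hU0
      · rcases hd j (U i) (U 0) hU0 with h | h
        · exact h
        · rw [h, hdU, mul_zero]

namespace IsShiftTable

variable {ν : Product K (Idx k s → K)}

theorem e_succ_or (hν : IsShiftTable ν) (m : ℕ) (a b : Idx k s → K) (hb : xCoord K k s b = 0) :
    eCoord K k s (m + 1) (ν a b) = 0 ∨
      eCoord K k s (m + 1) (ν a b) = eCoord K k s m a * eCoord K k s 0 b := by
  by_cases h : m + 1 < k
  · exact Or.inr (hν.e_succ m a b h hb)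
  · exact Or.inl (by simp [eCoord_of_le (not_lt.mp h)])

theorem f_succ_or (hν : IsShiftTable ν) (m : ℕ) (a b : Idx k s → K) (hb : xCoord K k s b = 0) :
    fCoord K k s (m + 1) (ν a b) = 0 ∨
      fCoord K k s (m + 1) (ν a b) = fCoord K k s m a * fCoord K k s 0 b := by
  by_cases h : m + 1 < s
  · exact Or.inr (hν.f_succ m a b h hb)
  · exact Or.inl (by simp [fCoord_of_le (not_lt.mp h)])

theorem e_zero_of (hν : IsShiftTable ν) (a b : Idx k s → K) (ha : xCoord K k s a = 0) (hb : xCoord K k s b = 0) :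
    eCoord K k s 0 (ν a b) = 0 := by simp [hν.e_zero, ha, hb]

/-- A chain of length `n` in the span of the `e_i` and `f_i` starting without `f_1`-component
has length at most `k`. -/
theorem length_le_of_f (hν : IsShiftTable ν) {n : ℕ} (hn : 2 ≤ n) {U : ℕ → Idx k s → K}
    (hU : ∀ i, i + 1 < n → U (i + 1) = ν (U i) (U 0)) (hx : xCoord K k s (U 0) = 0)
    (h0 : fCoord K k s 0 (U 0) = 0) (hne : U (n - 1) ≠ 0) : n ≤ k := by
  by_contra hlt
  obtain ⟨h1, h2, h3⟩ := chain_coords hν.x_mul hν.e_zero_of hν.e_succ_or hν.f_zero hν.f_succ_or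
    hU hx h0 (i := n - 1) (by omega)
  refine hne (coord_ext (fun i => ?_) (fun i => ?_) ?_)
  · by_cases hi : i < n - 1
    · rw [h2 i hi, map_zero]
    · rw [eCoord_of_le (by omega)]; simp
  · rw [h3 (by omega), map_zero]
  · rw [h1, map_zero]

/-- A chain of length `n` in the span of the `e_i` and `f_i` starting without `e_1`-component
has length at most `s`. -/
theorem length_le_of_e (hν : IsShiftTable ν) {n : ℕ} (hn : 2 ≤ n) {U : ℕ → Idx k s → K}
    (hU : ∀ i, i + 1 < n → U (i + 1) = ν (U i) (U 0)) (hx : xCoord K k s (U 0) = 0)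
    (h0 : eCoord K k s 0 (U 0) = 0) (hne : U (n - 1) ≠ 0) : n ≤ s := by
  by_contra hlt
  obtain ⟨h1, h2, h3⟩ := chain_coords hν.x_mul hν.f_zero hν.f_succ_or hν.e_zero_of hν.e_succ_or
    hU hx h0 (i := n - 1) (by omega)
  refine hne (coord_ext (fun i => ?_) (fun i => ?_) ?_)
  · rw [h3 (by omega), map_zero]
  · by_cases hi : i < n - 1
    · rw [h2 i hi, map_zero]
    · rw [fCoord_of_le (by omega)]; simp
  · rw [h1, map_zero]

/-- Within the ideal a product sees only the leading coordinates of its right factor. Read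
contrapositively: the image of a generator, whose square is nonzero, has a nonzero leading
coordinate. -/
theorem sq_eq_zero (hν : IsShiftTable ν) {u : Idx k s → K} (hx : xCoord K k s u = 0)
    (he : eCoord K k s 0 u = 0) (hf : fCoord K k s 0 u = 0) : ν u u = 0 := by
  refine coord_ext (fun i => ?_) (fun i => ?_) ?_
  · rcases i with _ | i
    · simp [hν.e_zero_of u u hx hx]
    · rcases hν.e_succ_or i u u hx with h | h <;> simp [h, he]
  · rcases i with _ | i
    · simp [hν.f_zero u u hx hx]
    · rcases hν.f_succ_or i u u hx with h | h <;> simp [h, hf]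
  · simp [hν.x_mul]

end IsShiftTable

/-! ### Products of the basis vectors, with indices running past the ends of the chains. -/

section Relations

theorem eVec_succ_eq {i : ℕ} (hi : i < k) :
    eVec K k s (i + 1) = Pi.basisFun K _ (Idx.e ⟨i, hi⟩) := (basisFun_e (K := K) ⟨i, hi⟩).symm

theorem fVec_succ_eq {i : ℕ} (hi : i < s) :
    fVec K k s (i + 1) = Pi.basisFun K _ (Idx.f ⟨i, hi⟩) := (basisFun_f (K := K) ⟨i, hi⟩).symm

section

variable (α : K)

theorem RDiag_eVec_eVec (i j : ℕ) :
    RDiag k s α (eVec K k s (i + 1)) (eVec K k s (j + 1)) = if j = 0 then eVec K k s (i + 2) else 0 := by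
  by_cases hi : i < k
  · by_cases hj : j < k
    · rw [eVec_succ_eq hi, eVec_succ_eq hj, RDiag, ofTable_basis]
    · rw [eVec_eq_zero (m := j + 1) (by omega), map_zero, if_neg (by omega)]
  · rw [eVec_eq_zero (m := i + 1) (by omega), map_zero, LinearMap.zero_apply]; simp [eVec_eq_zero (show k < i + 2 by omega)]

theorem RDiag_eVec_fVec (i j : ℕ) :
    RDiag k s α (eVec K k s (i + 1)) (fVec K k s (j + 1)) = 0 := by
  by_cases hi : i < k
  · by_cases hj : j < s
    · rw [eVec_succ_eq hi, fVec_succ_eq hj, RDiag, ofTable_basis]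
    · rw [fVec_eq_zero (m := j + 1) (by omega), map_zero]
  · rw [eVec_eq_zero (m := i + 1) (by omega), map_zero, LinearMap.zero_apply]

theorem RDiag_fVec_eVec (i j : ℕ) :
    RDiag k s α (fVec K k s (i + 1)) (eVec K k s (j + 1)) = 0 := by
  by_cases hi : i < s
  · by_cases hj : j < k
    · rw [fVec_succ_eq hi, eVec_succ_eq hj, RDiag, ofTable_basis]
    · rw [eVec_eq_zero (m := j + 1) (by omega), map_zero]
  · rw [fVec_eq_zero (m := i + 1) (by omega), map_zero, LinearMap.zero_apply]

theorem RDiag_fVec_fVec (i j : ℕ) :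
    RDiag k s α (fVec K k s (i + 1)) (fVec K k s (j + 1)) = if j = 0 then fVec K k s (i + 2) else 0 := by
  by_cases hi : i < s
  · by_cases hj : j < s
    · rw [fVec_succ_eq hi, fVec_succ_eq hj, RDiag, ofTable_basis]
    · rw [fVec_eq_zero (m := j + 1) (by omega), map_zero, if_neg (by omega)]
  · rw [fVec_eq_zero (m := i + 1) (by omega), map_zero, LinearMap.zero_apply]; simp [fVec_eq_zero (show s < i + 2 by omega)]

theorem RDiag_xVec_eVec (h : 0 < k) (j : ℕ) :
    RDiag k s α (xVec K k s) (eVec K k s (j + 1)) = if j = 0 then eVec K k s 1 else 0 := by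
  by_cases hj : j < k
  · rw [eVec_succ_eq hj, ← basisFun_x, RDiag, ofTable_basis]
  · rw [eVec_eq_zero (m := j + 1) (by omega), map_zero, if_neg (by omega)]

theorem RDiag_xVec_fVec (h : 0 < s) (j : ℕ) :
    RDiag k s α (xVec K k s) (fVec K k s (j + 1)) = if j = 0 then α • fVec K k s 1 else 0 := by
  by_cases hj : j < s
  · rw [fVec_succ_eq hj, ← basisFun_x, RDiag, ofTable_basis]
  · rw [fVec_eq_zero (m := j + 1) (by omega), map_zero, if_neg (by omega)]

theorem RDiag_eVec_xVec (i : ℕ) :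
    RDiag k s α (eVec K k s (i + 1)) (xVec K k s) = (-((i + 1 : ℕ) : K)) • eVec K k s (i + 1) := by
  by_cases hi : i < k
  · rw [eVec_succ_eq hi, ← basisFun_x, RDiag, ofTable_basis]; simp
  · simp [eVec_eq_zero (show k < i + 1 by omega)]

theorem RDiag_fVec_xVec (i : ℕ) :
    RDiag k s α (fVec K k s (i + 1)) (xVec K k s) = (-((i + 1 : ℕ) : K) * α) • fVec K k s (i + 1) := by
  by_cases hi : i < s
  · rw [fVec_succ_eq hi, ← basisFun_x, RDiag, ofTable_basis]; simp
  · simp [fVec_eq_zero (show s < i + 1 by omega)]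

theorem RDiag_xVec_xVec :
    RDiag k s α (xVec K k s) (xVec K k s) = 0 := by
  rw [← basisFun_x, RDiag, ofTable_basis]

end

section

variable (β : ℕ → K) (γ : K)

theorem RNil_eVec_eVec (i j : ℕ) :
    RNil k s β γ (eVec K k s (i + 1)) (eVec K k s (j + 1)) = if j = 0 then eVec K k s (i + 2) else 0 := by
  by_cases hi : i < k
  · by_cases hj : j < k
    · rw [eVec_succ_eq hi, eVec_succ_eq hj, RNil, ofTable_basis]
    · rw [eVec_eq_zero (m := j + 1) (by omega), map_zero, if_neg (by omega)]
  · rw [eVec_eq_zero (m := i + 1) (by omega), map_zero, LinearMap.zero_apply]; simp [eVec_eq_zero (show k < i + 2 by omega)]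

theorem RNil_eVec_fVec (i j : ℕ) :
    RNil k s β γ (eVec K k s (i + 1)) (fVec K k s (j + 1)) = 0 := by
  by_cases hi : i < k
  · by_cases hj : j < s
    · rw [eVec_succ_eq hi, fVec_succ_eq hj, RNil, ofTable_basis]
    · rw [fVec_eq_zero (m := j + 1) (by omega), map_zero]
  · rw [eVec_eq_zero (m := i + 1) (by omega), map_zero, LinearMap.zero_apply]

theorem RNil_fVec_eVec (i j : ℕ) :
    RNil k s β γ (fVec K k s (i + 1)) (eVec K k s (j + 1)) = 0 := by
  by_cases hi : i < s
  · by_cases hj : j < k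
    · rw [fVec_succ_eq hi, eVec_succ_eq hj, RNil, ofTable_basis]
    · rw [eVec_eq_zero (m := j + 1) (by omega), map_zero]
  · rw [fVec_eq_zero (m := i + 1) (by omega), map_zero, LinearMap.zero_apply]

theorem RNil_fVec_fVec (i j : ℕ) :
    RNil k s β γ (fVec K k s (i + 1)) (fVec K k s (j + 1)) = if j = 0 then fVec K k s (i + 2) else 0 := by
  by_cases hi : i < s
  · by_cases hj : j < s
    · rw [fVec_succ_eq hi, fVec_succ_eq hj, RNil, ofTable_basis]
    · rw [fVec_eq_zero (m := j + 1) (by omega), map_zero, if_neg (by omega)]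
  · rw [fVec_eq_zero (m := i + 1) (by omega), map_zero, LinearMap.zero_apply]; simp [fVec_eq_zero (show s < i + 2 by omega)]

theorem RNil_xVec_eVec (h : 0 < k) (j : ℕ) :
    RNil k s β γ (xVec K k s) (eVec K k s (j + 1)) = if j = 0 then eVec K k s 1 else 0 := by
  by_cases hj : j < k
  · rw [eVec_succ_eq hj, ← basisFun_x, RNil, ofTable_basis]
  · rw [eVec_eq_zero (m := j + 1) (by omega), map_zero, if_neg (by omega)]

theorem RNil_xVec_fVec (j : ℕ) :
    RNil k s β γ (xVec K k s) (fVec K k s (j + 1)) = 0 := by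
  by_cases hj : j < s
  · rw [fVec_succ_eq hj, ← basisFun_x, RNil, ofTable_basis]
  · rw [fVec_eq_zero (m := j + 1) (by omega), map_zero]

theorem RNil_eVec_xVec (i : ℕ) :
    RNil k s β γ (eVec K k s (i + 1)) (xVec K k s) = (-((i + 1 : ℕ) : K)) • eVec K k s (i + 1) := by
  by_cases hi : i < k
  · rw [eVec_succ_eq hi, ← basisFun_x, RNil, ofTable_basis]; simp
  · simp [eVec_eq_zero (show k < i + 1 by omega)]

theorem RNil_fVec_xVec (i : ℕ) :
    RNil k s β γ (fVec K k s (i + 1)) (xVec K k s) = ∑ j ∈ Finset.Icc (i + 2) s, β (j - (i + 1) + 1) • fVec K k s j := by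
  by_cases hi : i < s
  · rw [fVec_succ_eq hi, ← basisFun_x, RNil, ofTable_basis]
  · rw [fVec_eq_zero (by omega), Finset.Icc_eq_empty (by omega)]; simp

theorem RNil_xVec_xVec :
    RNil k s β γ (xVec K k s) (xVec K k s) = γ • fVec K k s s := by
  rw [← basisFun_x, RNil, ofTable_basis]

end

theorem RDiag_e_e (α : K) (i : ℕ) :
    RDiag k s α (eVec K k s (i + 1)) (eVec K k s 1) = eVec K k s (i + 2) :=
  RDiag_eVec_eVec α i 0

theorem RDiag_f_f (α : K) (i : ℕ) :
    RDiag k s α (fVec K k s (i + 1)) (fVec K k s 1) = fVec K k s (i + 2) :=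
  RDiag_fVec_fVec α i 0

theorem RNil_e_e (β : ℕ → K) (γ : K) (i : ℕ) :
    RNil k s β γ (eVec K k s (i + 1)) (eVec K k s 1) = eVec K k s (i + 2) :=
  RNil_eVec_eVec β γ i 0

theorem RNil_f_f (β : ℕ → K) (γ : K) (i : ℕ) :
    RNil k s β γ (fVec K k s (i + 1)) (fVec K k s 1) = fVec K k s (i + 2) :=
  RNil_fVec_fVec β γ i 0

theorem RNil_f_x (β : ℕ → K) (γ : K) :
    RNil k s β γ (fVec K k s 1) (xVec K k s) = ∑ j ∈ Finset.Icc 2 s, β j • fVec K k s j := by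
  rw [← Nat.zero_add 1, RNil_fVec_xVec]
  exact Finset.sum_congr rfl fun j hj => by
    rw [show j - (0 + 1) + 1 = j by have := Finset.mem_Icc.mp hj; omega]

end Relations

/-- In the second family no product has an `f_1`-component. The images `u`, `v` of both generators
are nonzero multiples of products, so their nonzero squares force both `e_1`-coordinates to be
nonzero, against `[u, v] = 0`. -/
theorem not_isomorphic_RDiag_RNil {k' s' : ℕ} (hk : 2 ≤ k) (hs : 2 ≤ s) (hk' : 2 ≤ k')
    (hs' : 2 ≤ s') {α : K} (hα : α ≠ 0) (β : ℕ → K) (γ : K) :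
    ¬ Isomorphic (RDiag k s α) (RNil k' s' β γ) := by
  rintro ⟨φ, hφ⟩
  have hν := isShiftTable_RNil (k := k') hs' β γ
  set X := φ (xVec K k s)
  set u := φ (eVec K k s 1) with hu
  set v := φ (fVec K k s 1) with hv
  have hXu : RNil k' s' β γ X u = u := by rw [← hφ]; exact congrArg φ (RDiag_xVec_eVec α (by omega) 0)
  have hXv : RNil k' s' β γ X v = α • v := by
    rw [← hφ, ← map_smul]; exact congrArg φ (RDiag_xVec_fVec α (by omega) 0)
  have huv : RNil k' s' β γ u v = 0 := by
    rw [← hφ, RDiag_eVec_fVec α 0 0, map_zero]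
  have huu : RNil k' s' β γ u u ≠ 0 := by
    rw [← hφ, RDiag_e_e α 0]
    simpa using eVec_ne_zero (m := 1) (by omega)
  have hvv : RNil k' s' β γ v v ≠ 0 := by
    rw [← hφ, RDiag_f_f α 0]
    simpa using fVec_ne_zero (m := 1) (by omega)
  have hux : xCoord K k' s' u = 0 := by rw [← hXu, hν.x_mul]
  have hvx : xCoord K k' s' v = 0 := by
    have := hν.x_mul X v
    rw [hXv] at this
    simpa [hα] using this
  have huf : fCoord K k' s' 0 u = 0 := by rw [← hXu, fCoord_RNil_zero _ _ _ _ hs']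
  have hvf : fCoord K k' s' 0 v = 0 := by
    have := fCoord_RNil_zero β γ X v hs'
    rw [hXv] at this
    simpa [hα] using this
  have hprod : eCoord K k' s' 0 u * eCoord K k' s' 0 v = 0 := by
    rw [← hν.e_succ 0 u v (by omega) hvx, huv, map_zero]
  rcases mul_eq_zero.mp hprod with h | h
  · exact huu (hν.sq_eq_zero hux h huf)
  · exact hvv (hν.sq_eq_zero hvx h hvf)

/-- The images of the generators are eigenvectors of left multiplication by `X` for 1 and α, and
this multiplication acts on the leading coordinates by ξ and α'ξ, where ξ is the x-coordinate of
`X`. Since `[u, v] = 0`, the two images lead in different chains. Either order is kept and ξ = 1, or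
it is reversed and ξ = α; then the chain lengths also agree. -/
theorem eq_or_of_isomorphic_RDiag (hk : 2 ≤ k) (hs : 2 ≤ s) {α α' : K} (hα : α ≠ 0)
    (h : Isomorphic (RDiag k s α) (RDiag k s α')) :
    α = α' ∨ (k = s ∧ α * α' = 1) := by
  obtain ⟨φ, hφ⟩ := h
  have hν := isShiftTable_RDiag (k := k) (s := s) α'
  set X := φ (xVec K k s)
  set u := φ (eVec K k s 1) with hu
  set v := φ (fVec K k s 1) with hv
  have hXu : RDiag k s α' X u = u := by rw [← hφ]; exact congrArg φ (RDiag_xVec_eVec α (by omega) 0)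
  have hXv : RDiag k s α' X v = α • v := by
    rw [← hφ, ← map_smul]; exact congrArg φ (RDiag_xVec_fVec α (by omega) 0)
  have huv : RDiag k s α' u v = 0 := by
    rw [← hφ, RDiag_eVec_fVec α 0 0, map_zero]
  have huu : RDiag k s α' u u ≠ 0 := by
    rw [← hφ, RDiag_e_e α 0]
    simpa using eVec_ne_zero (m := 1) (by omega)
  have hvv : RDiag k s α' v v ≠ 0 := by
    rw [← hφ, RDiag_f_f α 0]
    simpa using fVec_ne_zero (m := 1) (by omega)
  have hux : xCoord K k s u = 0 := by rw [← hXu, hν.x_mul]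
  have hvx : xCoord K k s v = 0 := by
    have := hν.x_mul X v
    rw [hXv] at this
    simpa [hα] using this
  have hprod : eCoord K k s 0 u * eCoord K k s 0 v = 0 := by
    rw [← hν.e_succ 0 u v (by omega) hvx, huv, map_zero]
  have hprod' : fCoord K k s 0 u * fCoord K k s 0 v = 0 := by
    rw [← hν.f_succ 0 u v (by omega) hvx, huv, map_zero]
  have hue : xCoord K k s X * eCoord K k s 0 u = eCoord K k s 0 u := by
    simpa [hXu, hux] using (hν.e_zero X u).symm
  have hve : xCoord K k s X * eCoord K k s 0 v = α * eCoord K k s 0 v := by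
    simpa [hXv, hvx] using (hν.e_zero X v).symm
  have huf : α' * (xCoord K k s X * fCoord K k s 0 u) = fCoord K k s 0 u := by
    simpa [hXu, hux] using (fCoord_RDiag_zero α' X u).symm
  have hvf : α' * (xCoord K k s X * fCoord K k s 0 v) = α * fCoord K k s 0 v := by
    simpa [hXv, hvx] using (fCoord_RDiag_zero α' X v).symm
  have hu0 := mt (fun h : _ ∧ _ => hν.sq_eq_zero hux h.1 h.2) huu
  have hv0 := mt (fun h : _ ∧ _ => hν.sq_eq_zero hvx h.1 h.2) hvv
  by_cases h : eCoord K k s 0 u = 0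
  · right
    have h1 : fCoord K k s 0 u ≠ 0 := fun h' => hu0 ⟨h, h'⟩
    have h2 : fCoord K k s 0 v = 0 := (mul_eq_zero.mp hprod').resolve_left h1
    have h3 : eCoord K k s 0 v ≠ 0 := fun h' => hv0 ⟨h', h2⟩
    have hX : xCoord K k s X = α := mul_right_cancel₀ h3 hve
    refine ⟨le_antisymm ?_ ?_, mul_right_cancel₀ h1 (by rw [hX] at huf; linear_combination huf)⟩
    · refine hν.length_le_of_e hk (U := fun i => φ (eVec K k s (i + 1))) (fun i hi => ?_) hux h ?_
      · simp only [← hφ, zero_add]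
        rw [RDiag_e_e]
      · simpa using eVec_ne_zero (m := k - 1) (by omega)
    · refine hν.length_le_of_f hs (U := fun i => φ (fVec K k s (i + 1))) (fun i hi => ?_) hvx h2 ?_
      · simp only [← hφ, zero_add]
        rw [RDiag_f_f]
      · simpa using fVec_ne_zero (m := s - 1) (by omega)
  · left
    have h1 : eCoord K k s 0 v = 0 := (mul_eq_zero.mp hprod).resolve_left h
    have h2 : fCoord K k s 0 v ≠ 0 := fun h' => hv0 ⟨h1, h'⟩
    have hX : xCoord K k s X = 1 := mul_right_cancel₀ h (by rw [hue, one_mul])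
    exact (mul_right_cancel₀ h2 (by rw [← hvf, hX, one_mul])).symm

/-- Any isomorphism between algebras of the second family is, up to terms of higher order, a
scaling of the `f_i`. -/
theorem of_isomorphic_RNil {k' s' : ℕ} (hk : 2 ≤ k) (hs : 2 ≤ s) (hk' : 2 ≤ k')
    (hs' : 2 ≤ s') {β β' : ℕ → K} {γ γ' : K} (h : Isomorphic (RNil k s β γ) (RNil k' s' β' γ')) :
    k ≤ k' ∧ (s = s' → ∃ A : K, A ≠ 0 ∧ (∀ i : ℕ, 2 ≤ i → i ≤ s → β i = A ^ (i - 1) * β' i) ∧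
      γ = A ^ s * γ') := by
  obtain ⟨φ, hφ⟩ := h
  have hν := isShiftTable_RNil (k := k') hs' β' γ'
  set X := φ (xVec K k s)
  set u := φ (eVec K k s 1) with hu
  set v := φ (fVec K k s 1) with hv
  have hXu : RNil k' s' β' γ' X u = u := by
    rw [← hφ]; exact congrArg φ (RNil_xVec_eVec β γ (by omega) 0)
  have hXv : RNil k' s' β' γ' X v = 0 := by rw [← hφ, RNil_xVec_fVec β γ 0, map_zero]
  have hvu : RNil k' s' β' γ' v u = 0 := by
    rw [← hφ, RNil_fVec_eVec β γ 0 0, map_zero]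
  have huu : RNil k' s' β' γ' u u ≠ 0 := by
    rw [← hφ, RNil_e_e β γ 0]
    simpa using eVec_ne_zero (m := 1) (by omega)
  have hvv : RNil k' s' β' γ' v v ≠ 0 := by
    rw [← hφ, RNil_f_f β γ 0]
    simpa using fVec_ne_zero (m := 1) (by omega)
  have hux : xCoord K k' s' u = 0 := by rw [← hXu, hν.x_mul]
  have huf : fCoord K k' s' 0 u = 0 := by rw [← hXu, fCoord_RNil_zero _ _ _ _ hs']
  have hue : eCoord K k' s' 0 u ≠ 0 := fun h => huu (hν.sq_eq_zero hux h huf)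
  have hX : xCoord K k' s' X = 1 := by
    have := hν.e_zero X u
    rw [hXu, hux] at this
    exact mul_right_cancel₀ hue (by linear_combination -this)
  have hvx : xCoord K k' s' v = 0 := by
    have := hν.e_zero v u
    rw [hvu, hux, map_zero] at this
    simpa [hue] using this
  have hve : eCoord K k' s' 0 v = 0 := by
    have := hν.e_succ 0 v u (by omega) hux
    rw [hvu, map_zero] at this
    simpa [hue] using this
  refine ⟨hν.length_le_of_f hk (U := fun i => φ (eVec K k s (i + 1))) (fun i hi => ?_) hux huf ?_,
    ?_⟩
  · simp only [← hφ, zero_add]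
    rw [RNil_e_e]
  · simpa using eVec_ne_zero (m := k - 1) (by omega)
  rintro rfl
  set t := fCoord K k' s 0 v with ht
  have ht0 : t ≠ 0 := fun h => hvv (hν.sq_eq_zero hvx hve h)
  have hVs : ∀ i, i + 1 < s → φ (fVec K k s (i + 2)) =
      RNil k' s β' γ' (φ (fVec K k s (i + 1))) v := fun i hi => by
    rw [← hφ, RNil_f_f]
  -- In its f-coordinates the image of `f_{i+1}` is `v` shifted by i places and multiplied by t^i.
  have hV : ∀ i, i < s → xCoord K k' s (φ (fVec K k s (i + 1))) = 0 ∧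
      (∀ j < i, fCoord K k' s j (φ (fVec K k s (i + 1))) = 0) ∧
      ∀ j, j + i < s → fCoord K k' s (j + i) (φ (fVec K k s (i + 1))) =
        t ^ i * fCoord K k' s j v := by
    intro i
    induction i with
    | zero => exact fun _ => ⟨hvx, by simp, by simp [hv]⟩
    | succ i ih =>
      intro hi
      obtain ⟨h1, h2, h3⟩ := ih (by omega)
      rw [hVs i hi]
      refine ⟨hν.x_mul _ _, fun j hj => ?_, fun j hj => ?_⟩
      · rcases j with _ | j
        · exact hν.f_zero _ _ h1 hvx
        · rw [hν.f_succ _ _ _ (by omega) hvx, h2 j (by omega), zero_mul]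
      · rw [← add_assoc, hν.f_succ _ _ _ (by omega) hvx, h3 j (by omega), pow_succ]
        ring
  -- From `[X, v] = 0`: only the last f-coordinate of `X` can be nonzero, and it does not enter the
  -- products below.
  have hXf : ∀ m, m + 1 < s → fCoord K k' s m X = 0 := fun m hm => by
    have := hν.f_succ m X v hm hvx
    rw [hXv, map_zero] at this
    simpa [← ht, ht0] using this
  -- Compare the coefficients of `f_{m+2}` in the image of `[f_1, x]` and in `[v, X]`.
  have key : ∀ m, m + 1 < s → ∑ l ∈ Finset.range (m + 1),
      (β' (l + 2) - t ^ (l + 1) * β (l + 2)) * fCoord K k' s (m - l) v = 0 := by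
    intro m hm
    have h1 := congrArg (fCoord K k' s (m + 1)) (hφ (fVec K k s 1) (xVec K k s))
    rw [RNil_f_x, fCoord_RNil_succ _ _ _ _ hm] at h1
    change _ = fCoord K k' s m v * fCoord K k' s 0 X + ∑ l ∈ Finset.range (m + 1), β' (l + 2) *
      (fCoord K k' s (m - l) v * xCoord K k' s X) + _ * (xCoord K k' s v * xCoord K k' s X) at h1
    rw [hXf 0 (by omega), hX, hvx] at h1
    simp only [map_sum, map_smul, smul_eq_mul, mul_one, mul_zero, zero_add, add_zero] at h1
    have h2 : ∑ j ∈ Finset.Icc 2 s, β j * fCoord K k' s (m + 1) (φ (fVec K k s j)) =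
        ∑ l ∈ Finset.range (m + 1), t ^ (l + 1) * β (l + 2) * fCoord K k' s (m - l) v := by
      rw [← Finset.sum_subset (s₁ := Finset.Ico 2 (m + 3)) (by grind) (fun j hj hj' => ?_),
        Finset.sum_Ico_eq_sum_range]
      · refine Finset.sum_congr (by simp) fun l hl => ?_
        have hl' := Finset.mem_range.mp hl
        rw [add_comm 2 l]
        have := (hV (l + 1) (by omega)).2.2 (m - l) (by omega)
        rw [show m - l + (l + 1) = m + 1 by omega] at this
        rw [this]
        ring
      · obtain ⟨j, rfl⟩ := Nat.exists_eq_add_of_le' (Finset.mem_Icc.mp hj).1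
        rw [(hV (j + 1) (by grind)).2.1 (m + 1) (by grind), mul_zero]
    rw [h2] at h1
    simp only [sub_mul, Finset.sum_sub_distrib]
    rw [h1, sub_self]
  -- The system `key` is triangular with the diagonal entry t ≠ 0.
  have hβ : ∀ m, m + 1 < s → β' (m + 2) = t ^ (m + 1) * β (m + 2) := by
    intro m
    induction m using Nat.strong_induction_on with
    | _ m ih =>
      intro hm
      have := key m hm
      rw [Finset.sum_eq_single m (fun l hl hlm => by
        rw [ih l (by grind) (by grind), sub_self, zero_mul]) (by simp), Nat.sub_self, ← ht] at this
      exact sub_eq_zero.mp ((mul_eq_zero.mp this).resolve_right ht0)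
  have hγ : γ' = t ^ s * γ := by
    obtain ⟨m, rfl⟩ := Nat.exists_eq_add_of_le' hs
    have h1 := congrArg (fCoord K k' (m + 2) (m + 1)) (hφ (xVec K k (m + 2)) (xVec K k (m + 2)))
    rw [RNil_xVec_xVec, fCoord_RNil_succ _ _ _ _ (by omega)] at h1
    change _ = fCoord K k' (m + 2) m X * fCoord K k' (m + 2) 0 X + ∑ l ∈ Finset.range (m + 1),
      β' (l + 2) * (fCoord K k' (m + 2) (m - l) X * xCoord K k' (m + 2) X) +
      _ * (xCoord K k' (m + 2) X * xCoord K k' (m + 2) X) at h1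
    rw [Finset.sum_eq_zero (fun l hl => by rw [hXf (m - l) (by omega)]; simp), hXf m (by omega),
      hX, map_smul, map_smul] at h1
    have h2 := (hV (m + 1) (by omega)).2.2 0 (by omega)
    rw [zero_add] at h2
    rw [h2, ← ht] at h1
    simp only [if_true, smul_eq_mul] at h1
    linear_combination -h1
  refine ⟨t⁻¹, inv_ne_zero ht0, fun i h2 hi => ?_, ?_⟩
  · obtain ⟨i, rfl⟩ := Nat.exists_eq_add_of_le' h2
    rw [hβ i (by omega), show i + 2 - 1 = i + 1 by omega, inv_pow, inv_mul_cancel_left₀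
      (pow_ne_zero _ ht0)]
  · rw [hγ, inv_pow, inv_mul_cancel_left₀ (pow_ne_zero _ ht0)]

end Comparison

/-! ### Recognising an algebra of the list from a suitable basis. -/

section Frames

variable {K R : Type*} [Field K] [AddCommGroup R] [Module K R] {k s : ℕ}

/-- The linear map sending the basis vectors `e_{i+1}`, `f_{i+1}`, `x` to `e i`, `f i`, `x`. -/
def frameMap (K : Type*) {R : Type*} [Field K] [AddCommGroup R] [Module K R] (k s : ℕ)
    (e f : ℕ → R) (x : R) : (Idx k s → K) →ₗ[K] R :=
  (Pi.basisFun K (Idx k s)).constr K fun p => match p with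
    | .e i => e i
    | .f i => f i
    | .x => x

section FrameMap

variable (e f : ℕ → R) (x : R)

theorem frameMap_basisFun_e (i : Fin k) :
    frameMap K k s e f x (Pi.basisFun K _ (Idx.e i)) = e i := by
  rw [frameMap, Module.Basis.constr_basis]

theorem frameMap_basisFun_f (i : Fin s) :
    frameMap K k s e f x (Pi.basisFun K _ (Idx.f i)) = f i := by
  rw [frameMap, Module.Basis.constr_basis]

theorem frameMap_xVec : frameMap K k s e f x (xVec K k s) = x := by
  rw [frameMap, xVec, Module.Basis.constr_basis]

theorem frameMap_eVec (he : ∀ i, k ≤ i → e i = 0) (m : ℕ) :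
    frameMap K k s e f x (eVec K k s (m + 1)) = e m := by
  by_cases h : m < k
  · rw [eVec_succ_eq h, frameMap_basisFun_e]
  · rw [eVec_eq_zero (by omega), he m (by omega), map_zero]

theorem frameMap_fVec (hf : ∀ i, s ≤ i → f i = 0) (m : ℕ) :
    frameMap K k s e f x (fVec K k s (m + 1)) = f m := by
  by_cases h : m < s
  · rw [fVec_succ_eq h, frameMap_basisFun_f]
  · rw [fVec_eq_zero (by omega), hf m (by omega), map_zero]

theorem map_frameMap (c : R →ₗ[K] K) (w : Idx k s → K) :
    c (frameMap K k s e f x w) = ∑ i : Fin k, w (.e i) * c (e i) +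
      ∑ j : Fin s, w (.f j) * c (f j) + w .x * c x := by
  let G : (Idx k s → K) →ₗ[K] K := ∑ i : Fin k, c (e i) • LinearMap.proj (Idx.e i) +
    ∑ j : Fin s, c (f j) • LinearMap.proj (Idx.f j) + c x • LinearMap.proj Idx.x
  have : c ∘ₗ frameMap K k s e f x = G := by
    refine (Pi.basisFun K _).ext fun p => ?_
    classical
    rcases p with i | i | _
    · rw [LinearMap.comp_apply, frameMap_basisFun_e]
      simp [G, -basisFun_e, Pi.basisFun_apply, Pi.single_apply]
    · rw [LinearMap.comp_apply, frameMap_basisFun_f]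
      simp [G, -basisFun_f, Pi.basisFun_apply, Pi.single_apply]
    · rw [LinearMap.comp_apply, basisFun_x, frameMap_xVec]
      simp [G, xVec, Pi.basisFun_apply]
  rw [← LinearMap.comp_apply, this]
  simp [G, mul_comm]

/-- A family that is triangular with respect to linear forms `c i`, `d i`, `ξ` is linearly
independent. Here `e 0` and `f 0` may have higher components in the span of the other chain. -/
theorem frameMap_injective {e f : ℕ → R} {x : R} {c d : ℕ → R →ₗ[K] K} {ξ : R →ₗ[K] K}
    (hξe : ∀ i, ξ (e i) = 0) (hξf : ∀ i, ξ (f i) = 0) (hξx : ξ x ≠ 0)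
    (hce : ∀ i j, i < j → c i (e j) = 0) (hce' : ∀ i < k, c i (e i) ≠ 0)
    (hdf : ∀ i j, i < j → d i (f j) = 0) (hdf' : ∀ i < s, d i (f i) ≠ 0)
    (hcf : ∀ i j, i = 0 ∨ 0 < j → c i (f j) = 0) (hde : ∀ i j, i = 0 ∨ 0 < j → d i (e j) = 0) :
    Function.Injective (frameMap K k s e f x) := by
  rw [injective_iff_map_eq_zero]
  intro w hw
  have hx : w .x = 0 := by
    have := map_frameMap e f x ξ w
    simpa [hw, hξe, hξf, hξx] using this
  -- Both chains are treated at the same level: a foreign component at level m > 0 can come only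
  -- from `e 0` or `f 0`, whose coefficients vanish by level 0.
  have main : ∀ m, (∀ h : m < k, w (.e ⟨m, h⟩) = 0) ∧ (∀ h : m < s, w (.f ⟨m, h⟩) = 0) := by
    intro m
    induction m using Nat.strong_induction_on with
    | _ m ih =>
      constructor
      · intro h
        have := map_frameMap e f x (c m) w
        rw [hw, map_zero, hx, zero_mul, add_zero, Finset.sum_eq_single ⟨m, h⟩,
          Finset.sum_eq_zero, add_zero] at this
        · exact (mul_eq_zero.mp this.symm).resolve_right (hce' m h)
        · rintro ⟨j, hj⟩ -
          by_cases h0 : m = 0 ∨ 0 < j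
          · rw [hcf _ _ h0, mul_zero]
          · rw [(ih j (by omega)).2 hj, zero_mul]
        · rintro ⟨j, hj⟩ - hne
          rcases lt_or_gt_of_ne (fun h' => hne (Fin.ext h') : j ≠ m) with h' | h'
          · rw [(ih j h').1 hj, zero_mul]
          · rw [hce m j h', mul_zero]
        · simp
      · intro h
        have := map_frameMap e f x (d m) w
        rw [hw, map_zero, hx, zero_mul, add_zero, add_comm, Finset.sum_eq_single ⟨m, h⟩,
          Finset.sum_eq_zero, add_zero] at this
        · exact (mul_eq_zero.mp this.symm).resolve_right (hdf' m h)
        · rintro ⟨j, hj⟩ -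
          by_cases h0 : m = 0 ∨ 0 < j
          · rw [hde _ _ h0, mul_zero]
          · rw [(ih j (by omega)).1 hj, zero_mul]
        · rintro ⟨j, hj⟩ - hne
          rcases lt_or_gt_of_ne (fun h' => hne (Fin.ext h') : j ≠ m) with h' | h'
          · rw [(ih j h').2 hj, zero_mul]
          · rw [hdf m j h', mul_zero]
        · simp
  funext p
  rcases p with ⟨i, hi⟩ | ⟨i, hi⟩ | _
  · exact (main i).1 hi
  · exact (main i).2 hi
  · exact hx

end FrameMap

/-- Two null-filiform chains `e` and `f` of lengths `k` and `s` that annihilate each other, and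
an element `x` annihilated from the right by all but the first members of the chains. -/
structure IsFrame (μ : Product K R) (k s : ℕ) (e f : ℕ → R) (x : R) : Prop where
  e_zero : ∀ i, k ≤ i → e i = 0
  f_zero : ∀ i, s ≤ i → f i = 0
  e_e : ∀ i, μ (e i) (e 0) = e (i + 1)
  f_f : ∀ i, μ (f i) (f 0) = f (i + 1)
  e_e_succ : ∀ i j, μ (e i) (e (j + 1)) = 0
  f_f_succ : ∀ i j, μ (f i) (f (j + 1)) = 0
  e_f : ∀ i j, μ (e i) (f j) = 0
  f_e : ∀ i j, μ (f i) (e j) = 0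
  x_e_succ : ∀ j, μ x (e (j + 1)) = 0
  x_f_succ : ∀ j, μ x (f (j + 1)) = 0
  injective : Function.Injective (frameMap K k s e f x)
  finrank_eq : Module.finrank K R = Module.finrank K (Idx k s → K)

theorem isomorphic_of_frameMap {μ : Product K R} [FiniteDimensional K R] {e f : ℕ → R} {x : R}
    (h : IsFrame μ k s e f x) (t : Idx k s → Idx k s → (Idx k s → K))
    (ht : ∀ p q, frameMap K k s e f x (t p q) = μ (frameMap K k s e f x (Pi.basisFun K _ p))
      (frameMap K k s e f x (Pi.basisFun K _ q))) :
    Isomorphic μ (ofTable t) := by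
  refine Isomorphic.symm ⟨LinearMap.linearEquivOfInjective _ h.injective h.finrank_eq.symm,
    fun a b => ?_⟩
  have : (ofTable t).compr₂ (frameMap K k s e f x) =
      μ.compl₁₂ (frameMap K k s e f x) (frameMap K k s e f x) := by
    refine (Pi.basisFun K _).ext fun p => (Pi.basisFun K _).ext fun q => ?_
    rw [LinearMap.compr₂_apply, ofTable_basis, ht, LinearMap.compl₁₂_apply]
  simpa using LinearMap.congr_fun (LinearMap.congr_fun this a) b

theorem IsFrame.isomorphic_RDiag {μ : Product K R} [FiniteDimensional K R] {e f : ℕ → R} {x : R}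
    (h : IsFrame μ k s e f x) {α : K} (hxx : μ x x = 0) (hxe : μ x (e 0) = e 0)
    (hxf : μ x (f 0) = α • f 0) (hex : ∀ i, μ (e i) x = (-((i + 1 : ℕ) : K)) • e i)
    (hfx : ∀ i, μ (f i) x = (-((i + 1 : ℕ) : K) * α) • f i) :
    Isomorphic μ (RDiag k s α) := by
  have hE := frameMap_eVec (K := K) (s := s) e f x h.e_zero
  have hF := frameMap_fVec (K := K) (k := k) e f x h.f_zero
  refine isomorphic_of_frameMap h _ ?_
  rintro (i | i | _) (⟨_ | j, hj⟩ | ⟨_ | j, hj⟩ | _) <;>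
    simp only [basisFun_e, basisFun_f, basisFun_x, hE, hF, frameMap_xVec, map_zero, map_smul, h.e_e,
      h.f_f, h.e_e_succ, h.f_f_succ, h.e_f, h.f_e, h.x_e_succ, h.x_f_succ, hxx, hxe, hxf, hex, hfx,
      if_true, Nat.succ_ne_zero, if_false]

theorem IsFrame.isomorphic_RNil {μ : Product K R} [FiniteDimensional K R] {e f : ℕ → R} {x : R}
    (h : IsFrame μ k s e f x) (hs : 0 < s) {β : ℕ → K} {γ : K} (hxx : μ x x = γ • f (s - 1))
    (hxe : μ x (e 0) = e 0) (hxf : μ x (f 0) = 0)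
    (hex : ∀ i, μ (e i) x = (-((i + 1 : ℕ) : K)) • e i)
    (hfx : ∀ i, μ (f i) x = ∑ j ∈ Finset.Icc (i + 2) s, β (j - (i + 1) + 1) • f (j - 1)) :
    Isomorphic μ (RNil k s β γ) := by
  have hE := frameMap_eVec (K := K) (s := s) e f x h.e_zero
  have hF := frameMap_fVec (K := K) (k := k) e f x h.f_zero
  refine isomorphic_of_frameMap h _ ?_
  rintro (i | i | _) (⟨_ | j, hj⟩ | ⟨_ | j, hj⟩ | _) <;>
    simp only [basisFun_e, basisFun_f, basisFun_x, hE, hF, frameMap_xVec, map_zero, map_smul, h.e_e,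
      h.f_f, h.e_e_succ, h.f_f_succ, h.e_f, h.f_e, h.x_e_succ, h.x_f_succ, hxx, hxe, hxf, hex, hfx,
      if_true, Nat.succ_ne_zero, if_false, map_sum]
  · refine Finset.sum_congr rfl fun j hj => ?_
    obtain ⟨j, rfl⟩ := Nat.exists_eq_add_of_le' (Finset.mem_Icc.mp hj).1
    exact congrArg _ (hF _)
  · obtain ⟨s, rfl⟩ := Nat.exists_eq_add_of_le' hs
    exact congrArg _ (hF _)

/-- Exchange the chains and replace x by α'x: the eigenvalues α, 1 become 1, α'. -/
theorem RDiag_swap (hk : 2 ≤ k) {α α' : K} (h : α * α' = 1) :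
    Isomorphic (RDiag k k α) (RDiag k k α') := by
  have hα : α' ≠ 0 := right_ne_zero_of_mul_eq_one h
  have hk0 : 0 < k := by omega
  refine IsFrame.isomorphic_RDiag (e := fun i => fVec K k k (i + 1))
    (f := fun i => eVec K k k (i + 1)) (x := α' • xVec K k k)
    ⟨fun i hi => fVec_eq_zero (by omega), fun i hi => eVec_eq_zero (by omega), ?_, ?_, ?_, ?_, ?_,
      ?_, ?_, ?_, ?_, rfl⟩ ?_ ?_ ?_ ?_ ?_
  case refine_9 =>
    refine frameMap_injective (c := fCoord K k k) (d := eCoord K k k) (ξ := xCoord K k k)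
      ?_ ?_ ?_ ?_ ?_ ?_ ?_ ?_ ?_ <;> simp_all <;> omega
  all_goals
    intros
    simp [RDiag_eVec_eVec, RDiag_fVec_fVec, RDiag_eVec_fVec, RDiag_fVec_eVec, RDiag_xVec_eVec,
      RDiag_xVec_fVec, RDiag_eVec_xVec, RDiag_fVec_xVec, RDiag_xVec_xVec, hk0, -Nat.cast_add,
      smul_smul]
  · rw [mul_comm, h, one_smul]
  · rw [show α' * (((_ + 1 : ℕ) : K) * α) = α * α' * ((_ + 1 : ℕ) : K) by ring, h, one_mul]
  · rw [mul_comm]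

/-- Replacing `f_i` by A^i `f_i` preserves the relations of the chain. -/
theorem RNil_rescale (hk : 2 ≤ k) (hs : 2 ≤ s) {β β' : ℕ → K} {γ γ' : K} {A : K} (hA : A ≠ 0)
    (hβ : ∀ i : ℕ, 2 ≤ i → i ≤ s → β i = A ^ (i - 1) * β' i) (hγ : γ = A ^ s * γ') :
    Isomorphic (RNil k s β γ) (RNil k s β' γ') := by
  have hk0 : 0 < k := by omega
  have hs0 : 0 < s := by omega
  refine IsFrame.isomorphic_RNil (e := fun i => eVec K k s (i + 1))
    (f := fun i => A ^ (i + 1) • fVec K k s (i + 1)) (x := xVec K k s)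
    ⟨fun i hi => eVec_eq_zero (by omega), fun i hi => ?_, ?_, ?_, ?_, ?_, ?_, ?_,
      ?_, ?_, ?_, rfl⟩ hs0 ?_ ?_ ?_ ?_ ?_
  case refine_1 => rw [fVec_eq_zero (by omega), smul_zero]
  case refine_10 =>
    refine frameMap_injective (c := eCoord K k s) (d := fCoord K k s) (ξ := xCoord K k s)
      ?_ ?_ ?_ ?_ ?_ ?_ ?_ ?_ ?_ <;> simp_all <;> omega
  case refine_11 =>
    rw [RNil_xVec_xVec, hγ, Nat.sub_add_cancel hs0, smul_smul, mul_comm]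
  case refine_15 =>
    intro i
    rw [map_smul, LinearMap.smul_apply, RNil_fVec_xVec, Finset.smul_sum]
    refine Finset.sum_congr rfl fun j hj => ?_
    have hj' := Finset.mem_Icc.mp hj
    obtain ⟨j, rfl⟩ := Nat.exists_eq_add_of_le' hj'.1
    rw [hβ _ (by omega) (by omega), smul_smul, smul_smul, show j + (i + 2) - 1 + 1 = j + (i + 2) by
      omega, show j + (i + 2) - (i + 1) + 1 - 1 = j + 1 by omega]
    congr 1
    ring
  all_goals
    intros
    simp [RNil_eVec_eVec, RNil_fVec_fVec, RNil_eVec_fVec, RNil_fVec_eVec, RNil_xVec_eVec,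
      RNil_xVec_fVec, RNil_eVec_xVec, hk0, -Nat.cast_add, smul_smul, pow_succ]
  congr 1
  ring

end Frames

/-- A Leibniz algebra with a hyperplane ideal, the kernel of `ξ`, that is the direct sum of two
null-filiform algebras with the bases `e 0, …, e (k - 1)` and `f 0, …, f (s - 1)`; the linear forms
`c i` and `d i` are the coordinates on that ideal. -/
structure HasChains {K R : Type*} [Field K] [AddCommGroup R] [Module K R] (μ : Product K R)
    (k s : ℕ) (e f : ℕ → R) (c d : ℕ → R →ₗ[K] K) (ξ : R →ₗ[K] K) : Prop where
  leibniz : IsLeibniz μ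
  two_le_k : 2 ≤ k
  two_le_s : 2 ≤ s
  e_zero : ∀ i, k ≤ i → e i = 0
  f_zero : ∀ i, s ≤ i → f i = 0
  c_zero : ∀ i, k ≤ i → c i = 0
  d_zero : ∀ i, s ≤ i → d i = 0
  c_e : ∀ i j, i < k → c i (e j) = if i = j then 1 else 0
  d_f : ∀ i j, i < s → d i (f j) = if i = j then 1 else 0
  c_f : ∀ i j, c i (f j) = 0
  d_e : ∀ i j, d i (e j) = 0
  ξ_e : ∀ i, ξ (e i) = 0
  ξ_f : ∀ i, ξ (f i) = 0
  expand : ∀ w, ξ w = 0 →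
    w = ∑ i ∈ Finset.range k, c i w • e i + ∑ j ∈ Finset.range s, d j w • f j
  ξ_mul_left : ∀ a w, ξ w = 0 → ξ (μ a w) = 0
  ξ_mul_right : ∀ a w, ξ w = 0 → ξ (μ w a) = 0
  e_e : ∀ i, μ (e i) (e 0) = e (i + 1)
  f_f : ∀ i, μ (f i) (f 0) = f (i + 1)
  e_f : ∀ i j, μ (e i) (f j) = 0
  f_e : ∀ i j, μ (f i) (e j) = 0

/-! ### Consequences of the Leibniz identity for left and right multiplications. -/

namespace HasChains

variable {K R : Type*} [Field K] [AddCommGroup R] [Module K R] {μ : Product K R}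
  {k s : ℕ} {e f : ℕ → R} {c d : ℕ → R →ₗ[K] K} {ξ : R →ₗ[K] K}

theorem swap (h : HasChains μ k s e f c d ξ) : HasChains μ s k f e d c ξ :=
  ⟨h.leibniz, h.two_le_s, h.two_le_k, h.f_zero, h.e_zero, h.d_zero, h.c_zero, h.d_f, h.c_e, h.d_e,
    h.c_f, h.ξ_f, h.ξ_e, fun w hw => (h.expand w hw).trans (add_comm _ _), h.ξ_mul_left,
    h.ξ_mul_right, h.f_f, h.e_e, h.f_e, h.e_f⟩

/-- The right side of the Leibniz identity is antisymmetric in its last two arguments. -/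
theorem mul_symm (h : HasChains μ k s e f c d ξ) (a b x : R) :
    μ b (μ a x + μ x a) = 0 := by
  rw [map_add, h.leibniz, h.leibniz b x a]
  abel

theorem mul_sq (h : HasChains μ k s e f c d ξ) (b x : R) : μ b (μ x x) = 0 := by
  rw [h.leibniz, sub_self]

/-- The first case is a square; the Leibniz identity then passes the property along the chain. The
left factor is arbitrary, not only in the ideal. -/
theorem mul_e_succ (h : HasChains μ k s e f c d ξ) (a : R) (j : ℕ) : μ a (e (j + 1)) = 0 := by
  induction j generalizing a with
  | zero => rw [← h.e_e 0, h.mul_sq]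
  | succ j ih => rw [← h.e_e (j + 1), h.leibniz, ih, ih, map_zero, LinearMap.zero_apply, sub_zero]

theorem ext_zero (h : HasChains μ k s e f c d ξ) {w : R} (hw : ξ w = 0) (hc : ∀ i, c i w = 0)
    (hd : ∀ i, d i w = 0) : w = 0 := by
  rw [h.expand w hw]
  simp [hc, hd]

theorem ext (h : HasChains μ k s e f c d ξ) {w w' : R} (hw : ξ w = ξ w')
    (hc : ∀ i, c i w = c i w') (hd : ∀ i, d i w = d i w') : w = w' := by
  refine sub_eq_zero.mp (h.ext_zero ?_ (fun i => ?_) fun i => ?_) <;> rw [map_sub, sub_eq_zero]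
  exacts [hw, hc i, hd i]

theorem map_expand (h : HasChains μ k s e f c d ξ) {M : Type*} [AddCommGroup M] [Module K M]
    (φ : R →ₗ[K] M) {w : R} (hw : ξ w = 0) :
    φ w = ∑ i ∈ Finset.range k, c i w • φ (e i) + ∑ j ∈ Finset.range s, d j w • φ (f j) := by
  conv_lhs => rw [h.expand w hw]
  simp

theorem mul_right (h : HasChains μ k s e f c d ξ) (a : R) {w : R} (hw : ξ w = 0) :
    μ a w = c 0 w • μ a (e 0) + d 0 w • μ a (f 0) := by
  have hk := h.two_le_k
  have hs := h.two_le_s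
  rw [h.map_expand (μ a) hw, Finset.sum_eq_single 0, Finset.sum_eq_single 0]
  · intro j _ hj
    obtain ⟨j, rfl⟩ := Nat.exists_eq_succ_of_ne_zero hj
    rw [h.swap.mul_e_succ, smul_zero]
  · simp; omega
  · intro j _ hj
    obtain ⟨j, rfl⟩ := Nat.exists_eq_succ_of_ne_zero hj
    rw [h.mul_e_succ, smul_zero]
  · simp; omega

theorem mul_e_zero (h : HasChains μ k s e f c d ξ) {w : R} (hw : ξ w = 0) :
    μ w (e 0) = ∑ i ∈ Finset.range k, c i w • e (i + 1) := by
  have := h.map_expand (μ.flip (e 0)) hw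
  simpa [h.e_e, h.f_e] using this

theorem c_succ_mul_e_zero (h : HasChains μ k s e f c d ξ) {w : R} (hw : ξ w = 0) {m : ℕ}
    (hm : m + 1 < k) : c (m + 1) (μ w (e 0)) = c m w := by
  rw [h.mul_e_zero hw, map_sum, Finset.sum_eq_single m]
  · simp [h.c_e _ _ hm]
  · intro j _ hj
    simp [h.c_e _ _ hm, hj.symm]
  · simp; omega

theorem c_zero_mul_e_zero (h : HasChains μ k s e f c d ξ) {w : R} (hw : ξ w = 0) :
    c 0 (μ w (e 0)) = 0 := by
  have hk := h.two_le_k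
  rw [h.mul_e_zero hw, map_sum, Finset.sum_eq_zero]
  intro j _
  simp [h.c_e 0 (j + 1) (by omega)]

theorem d_mul_e_zero (h : HasChains μ k s e f c d ξ) {w : R} (hw : ξ w = 0) (m : ℕ) :
    d m (μ w (e 0)) = 0 := by
  rw [h.mul_e_zero hw, map_sum, Finset.sum_eq_zero]
  intro j _
  simp [h.d_e]

theorem mul_e_zero_eq_zero (h : HasChains μ k s e f c d ξ) {w : R} (hw : ξ w = 0)
    (hc : ∀ i, c i w = 0) : μ w (e 0) = 0 := by
  rw [h.mul_e_zero hw]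
  simp [hc]

/-- The products of the ideal with `e 0` and with `f 0` lie in different summands. -/
theorem cross (h : HasChains μ k s e f c d ξ) {w w' : R} (hw : ξ w = 0) (hw' : ξ w' = 0)
    (heq : μ w (f 0) = μ w' (e 0)) : μ w (f 0) = 0 := by
  refine h.ext_zero (h.ξ_mul_right _ _ hw) (fun i => h.swap.d_mul_e_zero hw i) fun i => ?_
  rw [heq, h.d_mul_e_zero hw']

theorem e_zero_mul (h : HasChains μ k s e f c d ξ) {w : R} (hw : ξ w = 0) (i : ℕ) :
    μ (e i) w = c 0 w • e (i + 1) := by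
  rw [h.mul_right _ hw, h.e_e, h.e_f, smul_zero, add_zero]

theorem ξ_e_mul (h : HasChains μ k s e f c d ξ) (i : ℕ) (x : R) : ξ (μ (e i) x) = 0 :=
  h.ξ_mul_right _ _ (h.ξ_e i)

theorem ξ_mul_e (h : HasChains μ k s e f c d ξ) (i : ℕ) (x : R) : ξ (μ x (e i)) = 0 :=
  h.ξ_mul_left _ _ (h.ξ_e i)

/-- Right multiplications map `e 0` into the span of the `e i` and the last of the `f i`. -/
theorem e_mul_mul_f (h : HasChains μ k s e f c d ξ) (x : R) : μ (μ (e 0) x) (f 0) = 0 := by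
  have h1 := h.leibniz (e 0) (f 0) x
  rw [h.e_f, map_zero, LinearMap.zero_apply, zero_sub,
    h.e_zero_mul (h.swap.ξ_e_mul 0 x)] at h1
  refine h.cross (h.ξ_e_mul 0 x) (w' := -(c 0 (μ (f 0) x)) • e 0) ?_ ?_
  · simp [h.ξ_e]
  · rw [map_smul, LinearMap.smul_apply, h.e_e, neg_smul, h1, neg_neg]

theorem d_e_mul (h : HasChains μ k s e f c d ξ) (x : R) {m : ℕ} (hm : m + 1 < s) :
    d m (μ (e 0) x) = 0 := by
  rw [← h.swap.c_succ_mul_e_zero (h.ξ_e_mul 0 x) hm, h.e_mul_mul_f, map_zero]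

/-- Multiply `e 0` by `w`; as k ≥ 2, the vector `e 1` is nonzero. -/
theorem c_zero_of_annihilates (h : HasChains μ k s e f c d ξ) {w : R} (hw : ξ w = 0)
    (hann : ∀ b, μ b w = 0) : c 0 w = 0 := by
  have hk := h.two_le_k
  have := congrArg (c 1) (h.e_zero_mul hw 0)
  rw [hann, map_zero, map_smul, h.c_e 1 _ (by omega)] at this
  simpa using this.symm

theorem c_mul_e (h : HasChains μ k s e f c d ξ) (x : R) :
    c 0 (μ x (e 0)) = -c 0 (μ (e 0) x) := by
  have := h.c_zero_of_annihilates (w := μ x (e 0) + μ (e 0) x)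
    (by rw [map_add, h.ξ_e_mul, h.ξ_mul_e, add_zero]) (fun b => h.mul_symm _ _ _)
  rw [map_add] at this
  exact eq_neg_of_add_eq_zero_left this

theorem d_mul_e (h : HasChains μ k s e f c d ξ) (x : R) : d 0 (μ x (e 0)) = 0 := by
  have hs := h.two_le_s
  have := h.swap.c_zero_of_annihilates (w := μ x (e 0) + μ (e 0) x)
    (by rw [map_add, h.ξ_e_mul, h.ξ_mul_e, add_zero]) (fun b => h.mul_symm _ _ _)
  rwa [map_add, h.d_e_mul x (by omega), add_zero] at this

/-- Subtract from `[x, x]` the multiple of x that puts it into the ideal, then multiply by x from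
the left: since `[x, [x, x]] = 0`, what remains is a multiple of (ξ[x, x])². -/
theorem ξ_sq (h : HasChains μ k s e f c d ξ) {x : R} (hx : ξ x ≠ 0) : ξ (μ x x) = 0 := by
  set z := μ x x with hz
  have h1 : ξ (z - (ξ z / ξ x) • x) = 0 := by
    rw [map_sub, map_smul, smul_eq_mul, div_mul_cancel₀ _ hx, sub_self]
  have h2 := h.ξ_mul_left x _ h1
  rw [map_sub, map_smul, h.mul_sq, ← hz, map_sub, map_zero, map_smul, zero_sub, neg_eq_zero,
    smul_eq_mul] at h2
  rcases mul_eq_zero.mp h2 with h3 | h3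
  · exact (div_eq_zero_iff.mp h3).resolve_right hx
  · exact h3

theorem c_sq (h : HasChains μ k s e f c d ξ) {x : R} (hx : ξ x ≠ 0) : c 0 (μ x x) = 0 :=
  h.c_zero_of_annihilates (h.ξ_sq hx) fun b => h.mul_sq b x

/-- The derivation rule for right multiplication by `x`. As a recursion it yields the triangular
shape and the diagonal entries. -/
theorem e_succ_mul (h : HasChains μ k s e f c d ξ) (x : R) (i : ℕ) :
    μ (e (i + 1)) x = μ (μ (e i) x) (e 0) + c 0 (μ (e 0) x) • e (i + 1) := by
  have := h.leibniz (e i) (e 0) x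
  rw [h.e_zero_mul (h.ξ_e_mul 0 x), h.e_e] at this
  rw [this]
  abel

theorem c_e_mul_of_lt (h : HasChains μ k s e f c d ξ) (x : R) {i j : ℕ} (hij : j < i) :
    c j (μ (e i) x) = 0 := by
  by_cases hjk : k ≤ j
  · rw [h.c_zero j hjk, LinearMap.zero_apply]
  induction i generalizing j with
  | zero => omega
  | succ i ih =>
    rw [h.e_succ_mul, map_add, map_smul, h.c_e _ _ (by omega), if_neg (by omega), smul_zero,
      add_zero]
    rcases j with _ | j
    · exact h.c_zero_mul_e_zero (h.ξ_e_mul i x)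
    · rw [h.c_succ_mul_e_zero (h.ξ_e_mul i x) (by omega), ih (by omega) (by omega)]

theorem c_e_mul_self (h : HasChains μ k s e f c d ξ) (x : R) {i : ℕ} (hi : i < k) :
    c i (μ (e i) x) = ((i + 1 : ℕ) : K) * c 0 (μ (e 0) x) := by
  induction i with
  | zero => simp
  | succ i ih =>
    rw [h.e_succ_mul, map_add, map_smul, h.c_e _ _ (by omega), if_pos rfl,
      h.c_succ_mul_e_zero (h.ξ_e_mul i x) hi, ih (by omega)]
    push_cast
    simp only [smul_eq_mul]
    ring

theorem d_e_succ_mul (h : HasChains μ k s e f c d ξ) (x : R) (i j : ℕ) :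
    d j (μ (e (i + 1)) x) = 0 := by
  rw [h.e_succ_mul, map_add, map_smul, h.d_e, smul_zero, add_zero,
    h.d_mul_e_zero (h.ξ_e_mul i x)]

/-- An element of the ideal is the sum of an element of the span of the `e i` and an element of the
span of the `f i`. -/
theorem exists_split (h : HasChains μ k s e f c d ξ) {z : R} (hz : ξ z = 0) :
    ∃ p q, z = p + q ∧ ξ p = 0 ∧ ξ q = 0 ∧ (∀ i, c i q = 0) ∧ (∀ i, d i p = 0) ∧
      (∀ i, c i p = c i z) ∧ ∀ i, d i q = d i z := by
  have hp : ∀ i, d i (∑ i ∈ Finset.range k, c i z • e i) = 0 := fun i => by simp [h.d_e]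
  have hq : ∀ i, c i (∑ i ∈ Finset.range s, d i z • f i) = 0 := fun i => by simp [h.c_f]
  refine ⟨_, _, h.expand z hz, by simp [h.ξ_e], by simp [h.ξ_f], hq, hp, fun i => ?_, fun i => ?_⟩
  · conv_rhs => rw [h.expand z hz, map_add, hq, add_zero]
  · conv_rhs => rw [h.expand z hz, map_add, hp, zero_add]

/-- Right multiplication by `x` is invertible on the span of the `e i` with `i > 0`. -/
theorem exists_mul_eq [CharZero K] (h : HasChains μ k s e f c d ξ) {x : R}
    (ha : c 0 (μ (e 0) x) ≠ 0) {z : R} (hz : ξ z = 0) (hc : c 0 z = 0) (hd : ∀ j, d j z = 0) :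
    ∃ t, ξ t = 0 ∧ c 0 t = 0 ∧ (∀ j, d j t = 0) ∧ μ t x = z := by
  -- Back substitution: the leading coordinate is removed by dividing by the diagonal entry (i +
  -- 2)a, nonzero in characteristic 0; n bounds the number of coordinates left.
  have main : ∀ n i : ℕ, k ≤ i + 1 + n → ∀ z, ξ z = 0 → (∀ j ≤ i, c j z = 0) → (∀ j, d j z = 0) →
      ∃ t, ξ t = 0 ∧ c 0 t = 0 ∧ (∀ j, d j t = 0) ∧ μ t x = z := by
    intro n
    induction n with
    | zero =>
      intro i hi z hz hc hd
      refine ⟨0, by simp, by simp, by simp, ?_⟩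
      rw [map_zero, LinearMap.zero_apply]
      refine (h.ext_zero hz (fun j => ?_) hd).symm
      by_cases hj : j ≤ i
      · exact hc j hj
      · rw [h.c_zero j (by omega), LinearMap.zero_apply]
    | succ n ih =>
      intro i hi z hz hc hd
      by_cases hik : k ≤ i + 1
      · exact ih i (by omega) z hz hc hd
      set r := c (i + 1) z / (((i + 1 + 1 : ℕ) : K) * c 0 (μ (e 0) x)) with hr
      have hne : ((i + 1 + 1 : ℕ) : K) * c 0 (μ (e 0) x) ≠ 0 :=
        mul_ne_zero (Nat.cast_ne_zero.mpr (by omega)) ha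
      obtain ⟨t, h1, h2, h3, h4⟩ := ih (i + 1) (by omega) (z - r • μ (e (i + 1)) x)
        (by rw [map_sub, map_smul, hz, h.ξ_e_mul, smul_zero, sub_zero])
        (fun j hj => by
          rw [map_sub, map_smul]
          rcases Nat.lt_or_ge j (i + 1) with hj' | hj'
          · rw [h.c_e_mul_of_lt x hj', hc j (by omega), smul_zero, sub_zero]
          · obtain rfl : j = i + 1 := by omega
            rw [h.c_e_mul_self x (by omega), hr, smul_eq_mul, div_mul_cancel₀ _ hne, sub_self])
        (fun j => by rw [map_sub, map_smul, hd, h.d_e_succ_mul, smul_zero, sub_zero])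
      refine ⟨t + r • e (i + 1), ?_, ?_, fun j => ?_, ?_⟩
      · rw [map_add, map_smul, h1, h.ξ_e, smul_zero, add_zero]
      · rw [map_add, map_smul, h2, h.c_e _ _ (by have := h.two_le_k; omega), if_neg (by omega),
          smul_zero, add_zero]
      · rw [map_add, map_smul, h3, h.d_e, smul_zero, add_zero]
      · rw [map_add, LinearMap.add_apply, h4, map_smul, LinearMap.smul_apply, sub_add_cancel]
  exact main k 0 (by omega) z hz (fun j hj => by rwa [Nat.le_zero.mp hj]) hd

end HasChains

/-! ### The filtration by leading index, nilpotency, and chains of eigenvectors. -/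

namespace HasChains

variable {K R : Type*} [Field K] [AddCommGroup R] [Module K R] {μ : Product K R}
  {k s : ℕ} {e f : ℕ → R} {c d : ℕ → R →ₗ[K] K} {ξ : R →ₗ[K] K}

/-- The elements of the kernel of `ξ` whose first `i` coordinates with respect to both chains
vanish. -/
def tail (c d : ℕ → R →ₗ[K] K) (ξ : R →ₗ[K] K) (i : ℕ) : Submodule K R where
  carrier := {w | ξ w = 0 ∧ ∀ j < i, c j w = 0 ∧ d j w = 0}
  zero_mem' := by simp
  add_mem' {a b} ha hb := ⟨by rw [map_add, ha.1, hb.1, add_zero], fun j hj => by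
    simp [ha.2 j hj, hb.2 j hj]⟩
  smul_mem' r a ha := ⟨by rw [map_smul, ha.1, smul_zero], fun j hj => by simp [ha.2 j hj]⟩

theorem tail_swap (i : ℕ) : tail d c ξ i = tail c d ξ i := by
  ext w
  exact ⟨fun h => ⟨h.1, fun j hj => (h.2 j hj).symm⟩, fun h => ⟨h.1, fun j hj => (h.2 j hj).symm⟩⟩

theorem tail_eq_bot (h : HasChains μ k s e f c d ξ) : tail c d ξ (max k s) = ⊥ := by
  rw [eq_bot_iff]
  intro w hw
  refine h.ext_zero hw.1 (fun i => ?_) fun i => ?_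
  · by_cases hi : i < max k s
    · exact (hw.2 i hi).1
    · rw [h.c_zero i (by omega), LinearMap.zero_apply]
  · by_cases hi : i < max k s
    · exact (hw.2 i hi).2
    · rw [h.d_zero i (by omega), LinearMap.zero_apply]

theorem mul_e_mem_tail (h : HasChains μ k s e f c d ξ) {i : ℕ} {w : R} (hw : w ∈ tail c d ξ i) :
    μ w (e 0) ∈ tail c d ξ (i + 1) := by
  refine ⟨h.ξ_mul_right _ _ hw.1, fun j hj => ⟨?_, h.d_mul_e_zero hw.1 j⟩⟩
  rcases j with _ | j
  · exact h.c_zero_mul_e_zero hw.1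
  · by_cases hjk : j + 1 < k
    · rw [h.c_succ_mul_e_zero hw.1 hjk]
      exact (hw.2 j (by omega)).1
    · rw [h.c_zero _ (by omega), LinearMap.zero_apply]

theorem mul_ker_mem_tail (h : HasChains μ k s e f c d ξ) {i : ℕ} {w n : R}
    (hw : w ∈ tail c d ξ i) (hn : ξ n = 0) : μ w n ∈ tail c d ξ (i + 1) := by
  rw [h.mul_right w hn]
  refine add_mem (Submodule.smul_mem _ _ (h.mul_e_mem_tail hw)) (Submodule.smul_mem _ _ ?_)
  rw [← tail_swap] at hw ⊢
  exact h.swap.mul_e_mem_tail hw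

/-- With zero eigenvalue the triangular matrix is strictly triangular. The stray component of `[f 0,
x]` sits at the last `e`, hence not at index 0, as k ≥ 2. -/
theorem c_mul_eq_zero (h : HasChains μ k s e f c d ξ) {x : R} (ha : c 0 (μ (e 0) x) = 0) {i j : ℕ}
    {w : R} (hw : w ∈ tail c d ξ i) (hj : j < i + 1) : c j (μ w x) = 0 := by
  have := h.map_expand ((c j) ∘ₗ μ.flip x) hw.1
  simp only [LinearMap.comp_apply, LinearMap.flip_apply] at this
  rw [this, Finset.sum_eq_zero, Finset.sum_eq_zero, add_zero]
  · intro l _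
    by_cases hl : l < i
    · rw [(hw.2 l hl).2, zero_smul]
    · rcases l with _ | l
      · obtain rfl : j = 0 := by omega
        rw [h.swap.d_e_mul x (by have := h.two_le_k; omega), smul_zero]
      · rw [h.swap.d_e_succ_mul, smul_zero]
  · intro l hlk
    by_cases hl : l < i
    · rw [(hw.2 l hl).1, zero_smul]
    · rcases Nat.lt_or_ge j l with hjl | hjl
      · rw [h.c_e_mul_of_lt x hjl, smul_zero]
      · obtain rfl : j = l := by omega
        rw [h.c_e_mul_self x (Finset.mem_range.mp hlk), ha, mul_zero, smul_zero]

theorem mul_mem_tail (h : HasChains μ k s e f c d ξ) {x : R} (ha : c 0 (μ (e 0) x) = 0)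
    (hd : d 0 (μ (f 0) x) = 0) {i : ℕ} {w : R} (hw : w ∈ tail c d ξ i) :
    μ w x ∈ tail c d ξ (i + 1) :=
  ⟨h.ξ_mul_right _ _ hw.1, fun _ hj => ⟨h.c_mul_eq_zero ha hw hj,
    h.swap.c_mul_eq_zero hd (by rwa [tail_swap]) hj⟩⟩

theorem exists_eq_smul_add {x : R} (hx : ξ x ≠ 0) (b : R) : ∃ (r : K) (n : R),
    ξ n = 0 ∧ b = r • x + n :=
  ⟨ξ b / ξ x, b - (ξ b / ξ x) • x, by simp [hx], by abel⟩

theorem mul_mem_tail_succ (h : HasChains μ k s e f c d ξ) {x : R} (hx : ξ x ≠ 0)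
    (ha : c 0 (μ (e 0) x) = 0) (hd : d 0 (μ (f 0) x) = 0) {i : ℕ} {w : R}
    (hw : w ∈ tail c d ξ i) (b : R) : μ w b ∈ tail c d ξ (i + 1) := by
  obtain ⟨r, n, hn, rfl⟩ := exists_eq_smul_add hx b
  rw [map_add, map_smul]
  exact add_mem (Submodule.smul_mem _ _ (h.mul_mem_tail ha hd hw)) (h.mul_ker_mem_tail hw hn)

theorem mul_e_mem_tail_one (h : HasChains μ k s e f c d ξ) {x : R} (hx : ξ x ≠ 0)
    (ha : c 0 (μ (e 0) x) = 0) (b : R) : μ b (e 0) ∈ tail c d ξ 1 := by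
  obtain ⟨r, n, hn, rfl⟩ := exists_eq_smul_add hx b
  rw [map_add, map_smul, LinearMap.add_apply, LinearMap.smul_apply]
  refine add_mem (Submodule.smul_mem _ _ ⟨h.ξ_mul_e 0 x, fun j hj => ?_⟩)
    (h.mul_e_mem_tail ⟨hn, by simp⟩)
  obtain rfl : j = 0 := by omega
  exact ⟨by rw [h.c_mul_e, ha, neg_zero], h.d_mul_e x⟩

theorem mul_mem_tail_succ' (h : HasChains μ k s e f c d ξ) {x : R} (hx : ξ x ≠ 0)
    (ha : c 0 (μ (e 0) x) = 0) (hd : d 0 (μ (f 0) x) = 0) {i : ℕ} {w : R}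
    (hw : w ∈ tail c d ξ i) (b : R) : μ b w ∈ tail c d ξ (i + 1) := by
  rw [h.mul_right b hw.1]
  rcases i with _ | i
  · refine add_mem (Submodule.smul_mem _ _ (h.mul_e_mem_tail_one hx ha b))
      (Submodule.smul_mem _ _ ?_)
    rw [← tail_swap]
    exact h.swap.mul_e_mem_tail_one hx hd b
  · rw [(hw.2 0 (by omega)).1, (hw.2 0 (by omega)).2]
    simp

theorem mul_mem_tail_zero (h : HasChains μ k s e f c d ξ) {x : R} (hx : ξ x ≠ 0) (a b : R) :
    μ a b ∈ tail c d ξ 0 := by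
  refine ⟨?_, by simp⟩
  obtain ⟨r, n, hn, rfl⟩ := exists_eq_smul_add hx a
  obtain ⟨r', n', hn', rfl⟩ := exists_eq_smul_add hx b
  simp [h.ξ_sq hx, h.ξ_mul_left _ _ hn', h.ξ_mul_right _ _ hn]

/-- If no element acts with a nonzero eigenvalue on the ideal, then the algebra is nilpotent. -/
theorem isNilpotentSub_top (h : HasChains μ k s e f c d ξ) {x : R} (hx : ξ x ≠ 0)
    (ha : c 0 (μ (e 0) x) = 0) (hd : d 0 (μ (f 0) x) = 0) : IsNilpotentSub μ ⊤ := by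
  -- The first commutator only reaches the kernel of `ξ`; each further one gains one place.
  have key : ∀ n, lowerCentral μ ⊤ (n + 1) ≤ tail c d ξ n := by
    intro n
    induction n with
    | zero =>
      exact sup_le (Submodule.map₂_le.mpr fun a _ b _ => h.mul_mem_tail_zero hx a b)
        (Submodule.map₂_le.mpr fun a _ b _ => h.mul_mem_tail_zero hx a b)
    | succ n ih =>
      exact sup_le
        (Submodule.map₂_le.mpr fun a ha' b _ => h.mul_mem_tail_succ hx ha hd (ih ha') b)
        (Submodule.map₂_le.mpr fun a _ b hb => h.mul_mem_tail_succ' hx ha hd (ih hb) a)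
  exact ⟨max k s + 1, le_bot_iff.mp ((key _).trans h.tail_eq_bot.le)⟩

/-- The properties of a chain on which left and right multiplication by `x` are diagonal, and which
agrees with the chain `e` to leading order. -/
structure IsEigenchain (μ : Product K R) (k : ℕ) (e f : ℕ → R) (c d : ℕ → R →ₗ[K] K)
    (ξ : R →ₗ[K] K) (x : R) (α : K) (u : ℕ → R) : Prop where
  zero : ∀ i, k ≤ i → u i = 0
  ξ_eq : ∀ i, ξ (u i) = 0
  c_eq_zero : ∀ i j, i < j → c i (u j) = 0
  c_self : ∀ i < k, c i (u i) = 1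
  d_eq_zero : ∀ i j, i = 0 ∨ 0 < j → d i (u j) = 0
  mul_zero : ∀ b, μ b (u 0) = μ b (e 0)
  mul_succ : ∀ b j, μ b (u (j + 1)) = 0
  mul_e : ∀ i, μ (u i) (e 0) = u (i + 1)
  mul_f : ∀ i, μ (u i) (f 0) = 0
  x_mul : μ x (e 0) = α • u 0
  mul_x : ∀ i, μ (u i) x = (-((i + 1 : ℕ) : K) * α) • u i

/-- The Leibniz identity for x, `e 0`, x gives `[[x, e 0], x] = -α[x, e 0]`, because `[x, x]` has no
e-part and so kills `e 0`. Thus `[x, e 0]` is an exact eigenvector; the derivation rule extends this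
to the chain it generates. -/
theorem exists_isEigenchain (h : HasChains μ k s e f c d ξ) {x : R} {α : K}
    (hα : α ≠ 0) (ha : c 0 (μ (e 0) x) = -α) (hξz : ξ (μ x x) = 0) (hz : ∀ i, c i (μ x x) = 0) :
    ∃ u, IsEigenchain μ k e f c d ξ x α u := by
  obtain ⟨u, hu0, hus⟩ : ∃ u : ℕ → R, u 0 = α⁻¹ • μ x (e 0) ∧ ∀ i, u (i + 1) = μ (u i) (e 0) :=
    ⟨fun i => Nat.rec (α⁻¹ • μ x (e 0)) (fun _ w => μ w (e 0)) i, rfl, fun _ => rfl⟩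
  have hxe : μ x (e 0) = α • u 0 := by rw [hu0, smul_inv_smul₀ hα]
  have hξ : ∀ i, ξ (u i) = 0 := by
    intro i
    induction i with
    | zero => rw [hu0, map_smul, h.ξ_mul_e, smul_zero]
    | succ i ih => rw [hus]; exact h.ξ_mul_right _ _ ih
  have hc0 : c 0 (u 0) = 1 := by
    rw [hu0, map_smul, h.c_mul_e, ha, neg_neg, smul_eq_mul, inv_mul_cancel₀ hα]
  have hd : ∀ i j, i = 0 ∨ 0 < j → d i (u j) = 0 := by
    rintro i (_ | j) hij
    · obtain rfl : i = 0 := by omega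
      rw [hu0, map_smul, h.d_mul_e, smul_zero]
    · rw [hus]; exact h.d_mul_e_zero (hξ j) i
  have hc : ∀ i j, i < j → c i (u j) = 0 := by
    intro i j hij
    by_cases hik : k ≤ i
    · rw [h.c_zero i hik, LinearMap.zero_apply]
    induction j generalizing i with
    | zero => omega
    | succ j ih =>
      rcases i with _ | i
      · rw [hus]; exact h.c_zero_mul_e_zero (hξ j)
      · rw [hus, h.c_succ_mul_e_zero (hξ j) (by omega), ih i (by omega) (by omega)]
  have hmul0 : ∀ b, μ b (u 0) = μ b (e 0) := fun b => by
    rw [h.mul_right b (hξ 0), hc0, hd 0 0 (Or.inl rfl), one_smul, zero_smul, add_zero]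
  have hd0 : μ (u 0) x = -α • u 0 := by
    have h1 := h.leibniz x (e 0) x
    rw [h.mul_right x (h.ξ_e_mul 0 x), ha, h.d_e_mul x (by have := h.two_le_s; omega),
      h.mul_e_zero_eq_zero hξz hz, sub_zero, zero_smul, add_zero] at h1
    rw [hu0, map_smul, LinearMap.smul_apply, ← h1, smul_comm]
  refine ⟨u, ⟨fun i hi => ?_, hξ, hc, fun i hi => ?_, hd, hmul0, fun b j => ?_, fun i => (hus i).symm,
    fun i => ?_, hxe, fun i => ?_⟩⟩
  · refine h.ext_zero (hξ i) (fun j => ?_) fun j => ?_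
    · by_cases hj : j < k
      · exact hc j i (by omega)
      · rw [h.c_zero j (by omega), LinearMap.zero_apply]
    · exact hd j i (Or.inr (by have := h.two_le_k; omega))
  · induction i with
    | zero => exact hc0
    | succ i ih => rw [hus, h.c_succ_mul_e_zero (hξ i) hi, ih (by omega)]
  · rw [h.mul_right b (hξ (j + 1)), hc 0 _ (by omega), hd 0 _ (Or.inl rfl), zero_smul, zero_smul,
      add_zero]
  · rcases i with _ | i
    · have h1 := h.leibniz x (e 0) (f 0)
      rw [h.e_f, map_zero] at h1
      have h2 := h.cross (h.ξ_mul_e 0 x) (h.swap.ξ_mul_e 0 x) (sub_eq_zero.mp h1.symm)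
      rw [hu0, map_smul, LinearMap.smul_apply, h2, smul_zero]
    · exact h.swap.mul_e_zero_eq_zero (hξ (i + 1)) fun j =>
        hd j _ (Or.inr (by omega))
  · induction i with
    | zero => simpa using hd0
    | succ i ih =>
      have h1 := h.leibniz (u i) (u 0) x
      rw [hd0, ih, map_smul, map_smul, LinearMap.smul_apply, hmul0, ← hus] at h1
      rw [sub_eq_iff_eq_add.mp h1.symm, ← add_smul]
      congr 1
      push_cast
      ring

end HasChains

/-! ### Normal forms for x and for the chains. -/

namespace HasChains

variable {K R : Type*} [Field K] [AddCommGroup R] [Module K R] {μ : Product K R}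
  {k s : ℕ} {e f : ℕ → R} {c d : ℕ → R →ₗ[K] K} {ξ : R →ₗ[K] K}

/-- The square of `x` can be freed from its component in the span of the `e i` by adding to `x` an
element that acts trivially from the right. -/
theorem exists_c_sq_eq_zero [CharZero K] (h : HasChains μ k s e f c d ξ) {x : R} (hx : ξ x ≠ 0)
    (ha : c 0 (μ (e 0) x) ≠ 0) : ∃ t, ξ t = 0 ∧ c 0 t = 0 ∧ (∀ j, d j t = 0) ∧
      (∀ b, μ b t = 0) ∧ (∀ i, c i (μ (x + t) (x + t)) = 0) ∧
      ∀ i, d i (μ (x + t) (x + t)) = d i (μ x x) := by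
  obtain ⟨p, q, hpq, hp, hq, hcq, hdp, hcp, hdq⟩ := h.exists_split (h.ξ_sq hx)
  -- As t annihilates from the right, the square of x + t is `[x, x] + [t, x]`; t is chosen to
  -- cancel the e-part `p`.
  obtain ⟨t, h1, h2, h3, h4⟩ := h.exists_mul_eq ha (z := -p) (by simp [hp])
    (by rw [map_neg, hcp, h.c_sq hx, neg_zero]) (fun j => by rw [map_neg, hdp, neg_zero])
  have hann : ∀ b, μ b t = 0 := fun b => by
    rw [h.mul_right b h1, h2, h3, zero_smul, zero_smul, add_zero]
  have hsq : μ (x + t) (x + t) = q := by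
    rw [map_add, hann, add_zero, map_add, LinearMap.add_apply, h4, hpq]
    abel
  refine ⟨t, h1, h2, h3, hann, fun i => ?_, fun i => ?_⟩
  · rw [hsq, hcq]
  · rw [hsq, hdq]

/-- Both eigenvalues are nonzero, so both parts of the square of x can be removed; the second
correction leaves the first part zero and right multiplication by x unchanged. -/
theorem isomorphic_RDiag [CharZero K] [FiniteDimensional K R] (h : HasChains μ k s e f c d ξ)
    (hfr : Module.finrank K R = Module.finrank K (Idx k s → K)) {x : R} (hx : ξ x ≠ 0) {α : K}
    (hα : α ≠ 0) (ha : c 0 (μ (e 0) x) = -1) (hd : d 0 (μ (f 0) x) = -α) :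
    Isomorphic μ (RDiag k s α) := by
  obtain ⟨t, ht, -, -, hann, hc, -⟩ := h.exists_c_sq_eq_zero hx (by simp [ha])
  have hx1 : ξ (x + t) ≠ 0 := by rwa [map_add, ht, add_zero]
  obtain ⟨t', ht', -, -, hann', hd', hc'⟩ := h.swap.exists_c_sq_eq_zero hx1
    (by rw [map_add, hann, add_zero, hd]; exact neg_ne_zero.mpr hα)
  set y := x + t + t' with hy
  have hmul : ∀ b, μ b y = μ b x := fun b => by
    rw [hy, map_add, map_add, hann, hann', add_zero, add_zero]
  have hξy : ξ y ≠ 0 := by rwa [hy, map_add, ht', add_zero]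
  have hyy : μ y y = 0 := h.ext_zero (h.ξ_sq hξy) (fun i => by rw [hc' i, hc i]) hd'
  obtain ⟨u, hu⟩ := h.exists_isEigenchain (x := y) one_ne_zero (by rw [hmul, ha])
    (by simp [hyy]) (by simp [hyy])
  obtain ⟨v, hv⟩ := h.swap.exists_isEigenchain (x := y) hα (by rw [hmul, hd])
    (by simp [hyy]) (by simp [hyy])
  refine IsFrame.isomorphic_RDiag (e := u) (f := v) (x := y) ⟨hu.zero, hv.zero, fun i => ?_,
    fun i => ?_, fun i j => hu.mul_succ _ _, fun i j => hv.mul_succ _ _, ?_, ?_,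
    fun j => hu.mul_succ _ _, fun j => hv.mul_succ _ _,
    frameMap_injective (c := c) (d := d) (ξ := ξ) hu.ξ_eq hv.ξ_eq hξy hu.c_eq_zero ?_ hv.c_eq_zero
    ?_ hv.d_eq_zero hu.d_eq_zero, hfr⟩ hyy ?_ ?_ (fun i => ?_) hv.mul_x
  · rw [hu.mul_zero, hu.mul_e]
  · rw [hv.mul_zero, hv.mul_e]
  · rintro i (_ | j)
    · rw [hv.mul_zero, hu.mul_f]
    · exact hv.mul_succ _ _
  · rintro i (_ | j)
    · rw [hu.mul_zero, hv.mul_f]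
    · exact hu.mul_succ _ _
  · exact fun i hi => by rw [hu.c_self i hi]; exact one_ne_zero
  · exact fun i hi => by rw [hv.c_self i hi]; exact one_ne_zero
  · rw [hu.mul_zero, hu.x_mul, one_smul]
  · rw [hv.mul_zero, hv.x_mul]
  · rw [hu.mul_x, mul_one]

/-- If `x` acts nilpotently on the second chain, then `x` times `f 0` lies in the span of the
`f i`. -/
theorem c_mul_f_eq_zero [CharZero K] (h : HasChains μ k s e f c d ξ) {x : R} (hx : ξ x ≠ 0)
    (ha : c 0 (μ (e 0) x) ≠ 0) (hd : d 0 (μ (f 0) x) = 0) (i : ℕ) : c i (μ x (f 0)) = 0 := by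
  have hk := h.two_le_k
  set w := μ x (f 0) with hw
  have hξw : ξ w = 0 := h.swap.ξ_mul_e 0 x
  have hcf : c 0 (μ (f 0) x) = 0 := h.swap.d_e_mul x (by omega)
  have hwe : μ w (e 0) = 0 := by
    have h1 := h.leibniz x (f 0) (e 0)
    rw [h.f_e, map_zero] at h1
    exact h.swap.cross hξw (h.ξ_mul_e 0 x) (sub_eq_zero.mp h1.symm)
  have hci : ∀ i, i + 1 < k → c i w = 0 := fun i hi => by
    rw [← h.c_succ_mul_e_zero hξw hi, hwe, map_zero]
  rcases lt_trichotomy (i + 1) k with hi | hi | hi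
  · exact hci i hi
  -- The last coordinate: `[w, x]` lies in the span of the f's, but right multiplication by x scales
  -- the last e-coordinate of `w` by ka ≠ 0.
  · have hwx : μ w x = μ (μ x x) (f 0) := by
      have h1 := h.leibniz x (f 0) x
      rw [h.mul_right x (h.swap.ξ_e_mul 0 x), hcf, hd, zero_smul, zero_smul, add_zero] at h1
      exact (sub_eq_zero.mp h1.symm)
    have h1 : c i (μ w x) = 0 := by rw [hwx]; exact h.swap.d_mul_e_zero (h.ξ_sq hx) i
    have h2 := h.map_expand ((c i) ∘ₗ μ.flip x) hξw
    simp only [LinearMap.comp_apply, LinearMap.flip_apply] at h2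
    rw [h1, Finset.sum_eq_single i, Finset.sum_eq_zero, add_zero, h.c_e_mul_self x (by omega),
      smul_eq_mul] at h2
    · refine (mul_eq_zero.mp h2.symm).resolve_right (mul_ne_zero (Nat.cast_ne_zero.mpr ?_) ha)
      omega
    · rintro (_ | l) _
      · rw [hw, h.swap.c_mul_e, hd, neg_zero, zero_smul]
      · rw [h.swap.d_e_succ_mul, smul_zero]
    · intro l hl hli
      rw [hci l (by have := Finset.mem_range.mp hl; omega), zero_smul]
    · simp; omega
  · rw [h.c_zero i (by omega), LinearMap.zero_apply]

/-- A normal form of `x` in the case that it acts nilpotently on the second chain. -/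
theorem exists_normalized [CharZero K] (h : HasChains μ k s e f c d ξ) {x : R} (hx : ξ x ≠ 0)
    (ha : c 0 (μ (e 0) x) = -1) (hd : d 0 (μ (f 0) x) = 0) :
    ∃ y, ξ y ≠ 0 ∧ c 0 (μ (e 0) y) = -1 ∧ d 0 (μ (f 0) y) = 0 ∧ μ y (f 0) = 0 ∧
      ∃ γ : K, μ y y = γ • f (s - 1) := by
  have hk := h.two_le_k
  have hs := h.two_le_s
  obtain ⟨s', hs'⟩ := Nat.exists_eq_add_of_le' (show 1 ≤ s by omega)
  set w := μ x (f 0) with hw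
  have hξw : ξ w = 0 := h.swap.ξ_mul_e 0 x
  have hcw : ∀ i, c i w = 0 := h.c_mul_f_eq_zero hx (by simp [ha]) hd
  have hdw : d 0 w = 0 := by rw [hw, h.swap.c_mul_e, hd, neg_zero]
  -- `w` shifted back by one place, so that `[p, f 0] = w` and x - p annihilates `f 0` from the
  -- left.
  set p := ∑ j ∈ Finset.range s', d (j + 1) w • f j with hp
  have hξp : ξ p = 0 := by simp [hp, h.ξ_f]
  have hcp : ∀ i, c i p = 0 := fun i => by simp [hp, h.c_f]
  have hpf : μ p (f 0) = w := by
    conv_rhs => rw [h.expand w hξw]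
    rw [hs', Finset.sum_range_succ', hdw, zero_smul, add_zero]
    simp [hp, h.f_f, hcw]
  have hx1 : ξ (x - p) ≠ 0 := by rwa [map_sub, hξp, sub_zero]
  have he1 : μ (e 0) (x - p) = μ (e 0) x := by
    rw [map_sub, h.e_zero_mul hξp, hcp, zero_smul, sub_zero]
  have hf1 : d 0 (μ (f 0) (x - p)) = 0 := by
    rw [map_sub, map_sub, hd, h.swap.e_zero_mul hξp, map_smul, h.d_f _ _ (by omega)]
    simp
  obtain ⟨t, h1, h2, h3, hann, h5, -⟩ := h.exists_c_sq_eq_zero hx1 (by simp [he1, ha])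
  set y := x - p + t with hy
  have hξy : ξ y ≠ 0 := by rwa [hy, map_add, h1, add_zero]
  have hfy : d 0 (μ (f 0) y) = 0 := by rw [hy, map_add, hann, add_zero, hf1]
  have hyf : μ y (f 0) = 0 := by
    rw [hy, map_add, map_sub, LinearMap.add_apply, LinearMap.sub_apply, hpf, ← hw, sub_self,
      zero_add]
    exact h.swap.mul_e_zero_eq_zero h1 h3
  -- Hence only the last f-coordinate of `[y, y]` can survive.
  have hz : μ (μ y y) (f 0) = 0 := by
    have h1 := h.leibniz y (f 0) y
    rw [hyf, h.mul_right y (h.swap.ξ_e_mul 0 y), h.swap.d_e_mul y (by omega), hfy, zero_smul,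
      zero_smul, add_zero, map_zero, LinearMap.zero_apply, zero_sub] at h1
    exact neg_eq_zero.mp h1.symm
  refine ⟨y, hξy, by rw [hy, map_add, hann, add_zero, he1, ha], hfy, hyf, d (s - 1) (μ y y), ?_⟩
  refine h.ext (by rw [map_smul, h.ξ_f, h.ξ_sq hξy, smul_zero])
    (fun i => by rw [h5, map_smul, h.c_f, smul_zero]) fun i => ?_
  rcases lt_trichotomy (i + 1) s with hi | hi | hi
  · rw [← h.swap.c_succ_mul_e_zero (h.ξ_sq hξy) hi, hz, map_zero, map_smul, h.d_f _ _ (by omega),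
      if_neg (by omega), smul_zero]
  · obtain rfl : i = s - 1 := by omega
    rw [map_smul, h.d_f _ _ (by omega), if_pos rfl, smul_eq_mul, mul_one]
  · rw [h.d_zero i (by omega)]
    simp

theorem isomorphic_RNil [CharZero K] [FiniteDimensional K R] (h : HasChains μ k s e f c d ξ)
    (hfr : Module.finrank K R = Module.finrank K (Idx k s → K)) {x : R} (hx : ξ x ≠ 0)
    (ha : c 0 (μ (e 0) x) = -1) (hd : d 0 (μ (f 0) x) = 0) :
    ∃ (β : ℕ → K) (γ : K), Isomorphic μ (RNil k s β γ) := by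
  have hk := h.two_le_k
  have hs := h.two_le_s
  obtain ⟨y, hξy, hay, hdy, hyf, γ, hyy⟩ := h.exists_normalized hx ha hd
  obtain ⟨u, hu⟩ := h.exists_isEigenchain (x := y) one_ne_zero hay
    (by rw [hyy, map_smul, h.ξ_f, smul_zero]) (fun i => by rw [hyy, map_smul, h.c_f, smul_zero])
  obtain ⟨m, hm⟩ := Nat.exists_eq_add_of_le' hk
  set w := μ (f 0) y with hw
  have hξw : ξ w = 0 := h.swap.ξ_e_mul 0 y
  -- Here k = m + 2. The last vector `e (m + 1)` has eigenvalue -k, so adding τ times it to `f 0`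
  -- removes the e-component of `[f 0, y]`.
  set τ := c (m + 1) w / ((m + 2 : ℕ) : K) with hτ
  let v : ℕ → R := fun j => if j = 0 then f 0 + τ • e (m + 1) else f j
  have hv0 : v 0 = f 0 + τ • e (m + 1) := rfl
  have hvs : ∀ j, v (j + 1) = f (j + 1) := fun j => rfl
  have hmulv : ∀ b, μ b (v 0) = μ b (f 0) := fun b => by
    rw [hv0, map_add, map_smul, h.mul_e_succ, smul_zero, add_zero]
  have hmulvs : ∀ b j, μ b (v (j + 1)) = 0 := fun b j => h.swap.mul_e_succ b j
  have hvf : ∀ i, μ (v i) (f 0) = v (i + 1) := by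
    rintro (_ | i)
    · rw [hv0, map_add, map_smul, LinearMap.add_apply, LinearMap.smul_apply, h.e_f, smul_zero,
        add_zero, h.f_f, hvs]
    · rw [hvs, h.f_f, hvs]
  have hve : ∀ i, μ (v i) (e 0) = 0 := by
    rintro (_ | i)
    · rw [hv0, map_add, map_smul, LinearMap.add_apply, LinearMap.smul_apply, h.f_e, h.e_e,
        h.e_zero _ (by omega), smul_zero, add_zero]
    · rw [hvs, h.f_e]
  have hvx : ∀ i, μ (v i) y = ∑ l ∈ Finset.range s, d (l + 1) w • f (i + l + 1) := by
    intro i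
    induction i with
    | zero =>
      rw [hv0, map_add, map_smul, LinearMap.add_apply, LinearMap.smul_apply, ← hw]
      refine h.ext (by simp [hξw, h.ξ_e_mul, h.ξ_f]) (fun i => ?_) fun i => ?_
      · rw [map_add, map_smul, map_sum, Finset.sum_eq_zero (fun l _ => by simp [h.c_f])]
        rcases lt_trichotomy (i + 1) k with hi | hi | hi
        · rw [h.c_e_mul_of_lt y (by omega), ← h.c_succ_mul_e_zero hξw hi, hw, h.swap.e_mul_mul_f]
          simp
        · obtain rfl : i = m + 1 := by omega
          rw [h.c_e_mul_self y (by omega), hay, hτ, smul_eq_mul]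
          have : ((m + 2 : ℕ) : K) ≠ 0 := Nat.cast_ne_zero.mpr (by omega)
          rw [show m + 1 + 1 = m + 2 from rfl]
          field_simp
          ring
        · rw [h.c_zero i (by omega)]
          simp
      · rw [map_add, map_smul, h.d_e_succ_mul, smul_zero, add_zero, map_sum]
        by_cases his : i < s
        · rcases i with _ | i
          · rw [hdy, Finset.sum_eq_zero]
            intro l _
            simp [h.d_f _ _ his]
          · rw [Finset.sum_eq_single i]
            · simp [h.d_f _ _ his]
            · intro l _ hl
              simp [h.d_f _ _ his, hl.symm]
            · simp; omega
        · simp [h.d_zero i (by omega)]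
    | succ i ih =>
      have h1 := h.leibniz (v i) (f 0) y
      rw [hvf, ih, h.mul_right (v i) hξw, hve, smul_zero, hdy, zero_smul, add_zero] at h1
      rw [sub_eq_zero.mp h1.symm]
      simp only [map_sum, LinearMap.sum_apply, map_smul, LinearMap.smul_apply, h.f_f]
      exact Finset.sum_congr rfl fun l _ => by rw [show i + 1 + l + 1 = i + l + 1 + 1 by ring]
  refine ⟨fun j => d (j - 1) w, γ, IsFrame.isomorphic_RNil (e := u) (f := v) (x := y)
    ⟨hu.zero, fun i hi => ?_, fun i => ?_,
    fun i => ?_, fun i j => hu.mul_succ _ _, fun i j => hmulvs _ _, ?_, ?_,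
    fun j => hu.mul_succ _ _, fun j => hmulvs _ _,
    frameMap_injective (c := c) (d := d) (ξ := ξ) hu.ξ_eq ?_ hξy hu.c_eq_zero ?_ ?_
    ?_ ?_ hu.d_eq_zero, hfr⟩ (by omega) ?_ ?_ ?_ (fun i => ?_) fun i => ?_⟩
  · obtain ⟨i, rfl⟩ := Nat.exists_eq_add_of_le' (show 1 ≤ i by omega)
    exact h.f_zero _ hi
  · rw [hu.mul_zero, hu.mul_e]
  · rw [hmulv, hvf]
  · rintro i (_ | j)
    · rw [hmulv, hu.mul_f]
    · exact hmulvs _ _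
  · rintro i (_ | j)
    · rw [hu.mul_zero, hve]
    · exact hu.mul_succ _ _
  · rintro (_ | i)
    · simp [hv0, h.ξ_f, h.ξ_e]
    · exact h.ξ_f _
  · exact fun i hi => by rw [hu.c_self i hi]; exact one_ne_zero
  · rintro i (_ | j) hij
    · omega
    · by_cases his : i < s
      · rw [hvs, h.d_f _ _ his, if_neg (by omega)]
      · rw [h.d_zero i (by omega), LinearMap.zero_apply]
  · rintro (_ | i) his
    · simp [hv0, h.d_f 0 _ his, h.d_e]
    · simp [hvs, h.d_f _ _ his]
  · rintro i (_ | j) hij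
    · obtain rfl : i = 0 := by omega
      simp [hv0, h.c_f, h.c_e 0 (m + 1) (by omega)]
    · rw [hvs, h.c_f]
  · obtain ⟨n, hn⟩ := Nat.exists_eq_add_of_le' hs
    rw [hyy, show s - 1 = n + 1 by omega, hvs]
  · rw [hu.mul_zero, hu.x_mul, one_smul]
  · rw [hmulv, hyf]
  · rw [hu.mul_x, mul_one]
  -- The added terms vanish because `f` is zero from index s on.
  · rw [hvx, Finset.sum_subset (s₁ := Finset.Icc (i + 2) s) (s₂ := Finset.Ico (i + 2) (i + 2 + s))
      (fun j hj => by rw [Finset.mem_Icc] at hj; rw [Finset.mem_Ico]; omega)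
      (fun j hj hj' => ?_), Finset.sum_Ico_eq_sum_range]
    · refine Finset.sum_congr (by simp) fun l _ => ?_
      rw [show i + 2 + l - (i + 1) + 1 - 1 = l + 1 by omega, show i + 2 + l - 1 = i + l + 1 by omega,
        hvs]
    · obtain ⟨j, rfl⟩ := Nat.exists_eq_add_of_le' (Finset.mem_Ico.mp hj).1
      rw [show j + (i + 2) - 1 = j + i + 1 by omega, hvs, h.f_zero _ (by rw [Finset.mem_Icc] at hj'; omega), smul_zero]

end HasChains

/-! ### From the abstract hypotheses to chains, and the choice of parameters. -/

section Classification

variable {K R : Type*} [Field K] [AddCommGroup R] [Module K R]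

theorem NF_single (n : ℕ) (i j : Fin n) :
    NF K n (Pi.single i 1) (Pi.single j 1) =
      if j.val = 0 then (fun m : Fin n => if m.val = i.val + 1 then (1 : K) else 0) else 0 := by
  have := ofTable_basis (K := K) (fun i j : Fin n => if j.val = 0 then
    (fun m : Fin n => if m.val = i.val + 1 then (1 : K) else 0) else 0) i j
  simpa [Pi.basisFun_apply, NF] using this

/-- The basis vector number `i` of `K ^ n`, or zero if there is none. -/
def stdVec (K : Type*) [Field K] (n i : ℕ) : Fin n → K := fun m => if m.val = i then 1 else 0

theorem stdVec_eq_zero {n i : ℕ} (h : n ≤ i) : stdVec K n i = 0 := by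
  funext m
  exact if_neg (by omega)

theorem stdVec_eq_single {n : ℕ} (i : Fin n) : stdVec K n i = Pi.single i 1 := by
  funext m
  simp [stdVec, Pi.single_apply, Fin.ext_iff]

theorem NF_stdVec (n i : ℕ) : NF K n (stdVec K n i) (stdVec K n 0) = stdVec K n (i + 1) := by
  by_cases hi : i < n
  · have h1 := NF_single (K := K) n ⟨i, hi⟩ ⟨0, by omega⟩
    rw [← stdVec_eq_single, ← stdVec_eq_single] at h1
    exact h1
  · rw [stdVec_eq_zero (not_lt.mp hi), stdVec_eq_zero (i := i + 1) (by omega), map_zero,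
      LinearMap.zero_apply]

theorem eq_sum_stdVec {n : ℕ} (v : Fin n → K) :
    v = ∑ i ∈ Finset.range n, (if h : i < n then v ⟨i, h⟩ else 0) • stdVec K n i := by
  rw [Finset.sum_range]
  funext m
  simp [stdVec, Fin.val_inj]

/-- The coordinate number `i` on `K ^ n`, or zero if there is none. -/
def stdCoord (K : Type*) [Field K] (n i : ℕ) : (Fin n → K) →ₗ[K] K :=
  if h : i < n then LinearMap.proj ⟨i, h⟩ else 0

theorem stdCoord_apply {n : ℕ} (i : ℕ) (v : Fin n → K) :
    stdCoord K n i v = if h : i < n then v ⟨i, h⟩ else 0 := by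
  unfold stdCoord
  split_ifs <;> rfl

theorem exists_hasChains {μ : Product K R} {N Q : Submodule K R} {k s : ℕ} (hk : 2 ≤ k)
    (hs : 2 ≤ s) (hμ : IsLeibniz μ) (hN : IsIdeal μ N)
    (hiso : SubIsomorphic μ N (directSum (NF K k) (NF K s))) (hNQ : IsCompl N Q)
    (hQ : Module.finrank K Q = 1) :
    ∃ (e f : ℕ → R) (c d : ℕ → R →ₗ[K] K) (ξ : R →ₗ[K] K), HasChains μ k s e f c d ξ ∧ ξ ≠ 0 := by
  obtain ⟨ψ, hinj, hrange, hψ⟩ := hiso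
  obtain ⟨g, hg⟩ := LinearMap.exists_leftInverse_of_injective ψ (LinearMap.ker_eq_bot.mpr hinj)
  have hgψ : ∀ v, g (ψ v) = v := fun v => LinearMap.congr_fun hg v
  have hNtop : N < ⊤ := by
    refine lt_top_iff_ne_top.mpr fun h => ?_
    have hbot : Q = ⊥ := by simpa [h] using hNQ.inf_eq_bot
    rw [hbot, finrank_bot] at hQ
    omega
  obtain ⟨ξ, hξ, hξN⟩ := Submodule.exists_le_ker_of_lt_top N hNtop
  -- The kernel of `ξ` is no larger than `N`, because `N` has codimension one.
  have hmem : ∀ w, ξ w = 0 → w ∈ N := by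
    intro w hw
    obtain ⟨q, hq0, hq⟩ := finrank_eq_one_iff'.mp hQ
    have hsplit : ∀ w : R, ∃ n ∈ N, ∃ r : K, w = n + r • (q : R) := fun w => by
      obtain ⟨n, hn, y, hy, rfl⟩ := Submodule.mem_sup.mp
        (hNQ.sup_eq_top ▸ Submodule.mem_top : w ∈ N ⊔ Q)
      obtain ⟨r, hr⟩ := hq ⟨y, hy⟩
      exact ⟨n, hn, r, by rw [← Submodule.coe_smul, hr]⟩
    have hξq : ξ (q : R) ≠ 0 := fun h0 => hξ <| LinearMap.ext fun w => by
      obtain ⟨n, hn, r, rfl⟩ := hsplit w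
      simp [h0, LinearMap.mem_ker.mp (hξN hn)]
    obtain ⟨n, hn, r, rfl⟩ := hsplit w
    have hr : r = 0 := by simpa [LinearMap.mem_ker.mp (hξN hn), hξq] using hw
    simpa [hr] using hn
  have hker : ∀ w, w ∈ N → ξ w = 0 := fun w hw => LinearMap.mem_ker.mp (hξN hw)
  have hψN : ∀ v, ψ v ∈ N := fun v => hrange ▸ LinearMap.mem_range_self ψ v
  refine ⟨fun i => ψ (stdVec K k i, 0), fun i => ψ (0, stdVec K s i),
    fun i => stdCoord K k i ∘ₗ LinearMap.fst K _ _ ∘ₗ g,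
    fun i => stdCoord K s i ∘ₗ LinearMap.snd K _ _ ∘ₗ g, ξ, ⟨hμ, hk, hs, ?_, ?_, ?_, ?_, ?_, ?_, ?_,
      ?_, ?_, ?_, ?_, ?_, ?_, ?_, ?_, ?_, ?_⟩, hξ⟩
  · intro i hi
    rw [stdVec_eq_zero hi]
    exact map_zero ψ
  · intro i hi
    rw [stdVec_eq_zero hi]
    exact map_zero ψ
  · intro i hi
    rw [stdCoord, dif_neg (by omega), LinearMap.zero_comp]
  · intro i hi
    rw [stdCoord, dif_neg (by omega), LinearMap.zero_comp]
  · intro i j hi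
    simp [hgψ, stdCoord_apply, hi, stdVec]
  · intro i j hi
    simp [hgψ, stdCoord_apply, hi, stdVec]
  · intro i j
    simp [hgψ]
  · intro i j
    simp [hgψ]
  · exact fun i => hker _ (hψN _)
  · exact fun i => hker _ (hψN _)
  · intro w hw
    obtain ⟨v, rfl⟩ : w ∈ LinearMap.range ψ := hrange ▸ hmem w hw
    simp only [LinearMap.comp_apply, hgψ, LinearMap.fst_apply, LinearMap.snd_apply, stdCoord_apply,
      ← map_smul, ← map_sum, ← map_add]
    congr 1
    refine Prod.ext ?_ ?_
    · simp only [Prod.fst_add, Prod.fst_sum, Prod.smul_fst, smul_zero, Finset.sum_const_zero,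
        add_zero]
      exact eq_sum_stdVec v.1
    · simp only [Prod.snd_add, Prod.snd_sum, Prod.smul_snd, smul_zero, Finset.sum_const_zero,
        zero_add]
      exact eq_sum_stdVec v.2
  · exact fun a w hw => hker _ (hN a w (hmem w hw)).1
  · exact fun a w hw => hker _ (hN a w (hmem w hw)).2
  · intro i
    rw [← hψ]
    simp [directSum, NF_stdVec]
  · intro i
    rw [← hψ]
    simp [directSum, NF_stdVec]
  · intro i j
    rw [← hψ]
    simp only [directSum, LinearMap.mk₂_apply, map_zero, LinearMap.zero_apply]
    exact map_zero ψ
  · intro i j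
    rw [← hψ]
    simp only [directSum, LinearMap.mk₂_apply, map_zero, LinearMap.zero_apply]
    exact map_zero ψ

/-- The labels of the basis as a disjoint union. -/
def idxEquiv (k s : ℕ) : Idx k s ≃ (Fin k ⊕ Fin s) ⊕ Unit where
  toFun
    | .e i => .inl (.inl i)
    | .f i => .inl (.inr i)
    | .x => .inr ()
  invFun
    | .inl (.inl i) => .e i
    | .inl (.inr i) => .f i
    | .inr () => .x
  left_inv p := by cases p <;> rfl
  right_inv p := by rcases p with (p | p) | p <;> rfl

theorem finrank_idx (k s : ℕ) : Module.finrank K (Idx k s → K) = k + s + 1 := by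
  rw [(LinearEquiv.funCongrLeft K K (idxEquiv k s).symm).finrank_eq]
  simp

theorem finiteDimensional_and_finrank {μ : Product K R} {N Q : Submodule K R} {k s : ℕ}
    (hiso : SubIsomorphic μ N (directSum (NF K k) (NF K s))) (hNQ : IsCompl N Q)
    (hQ : Module.finrank K Q = 1) :
    FiniteDimensional K R ∧ Module.finrank K R = k + s + 1 := by
  obtain ⟨ψ, hinj, hrange, -⟩ := hiso
  have hN : FiniteDimensional K N := hrange ▸ inferInstance
  have hQ' : FiniteDimensional K Q := Module.finite_of_finrank_eq_succ hQ
  have hR : FiniteDimensional K R := by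
    have : FiniteDimensional K (⊤ : Submodule K R) := hNQ.sup_eq_top ▸ inferInstance
    exact Module.finite_def.mpr (Module.Finite.iff_fg.mp this)
  refine ⟨hR, ?_⟩
  rw [← Submodule.finrank_add_eq_of_isCompl hNQ, hQ, ← hrange, LinearMap.finrank_range_of_inj hinj]
  simp

/-- Over an algebraically closed field, the parameters can be normalized. -/
theorem exists_firstNonzeroIsOne {k s : ℕ} (hk : 2 ≤ k) (hs : 2 ≤ s) (β : ℕ → K) (γ : K) :
    ∃ (β' : ℕ → K) (γ' : K), (IsAlgClosed K → FirstNonzeroIsOne s β' γ') ∧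
      Isomorphic (RNil k s β γ) (RNil k s β' γ') := by
  by_cases hK : IsAlgClosed K
  swap
  · exact ⟨β, γ, fun h => absurd h hK, ⟨LinearEquiv.refl K _, fun _ _ => rfl⟩⟩
  have key : ∀ A : K, A ≠ 0 → Isomorphic (RNil k s β γ)
      (RNil k s (fun i => A⁻¹ ^ (i - 1) * β i) (A⁻¹ ^ s * γ)) := fun A hA =>
    RNil_rescale hk hs hA (fun i _ _ => by
      rw [← mul_assoc, ← mul_pow, mul_inv_cancel₀ hA, one_pow, one_mul])
      (by rw [← mul_assoc, ← mul_pow, mul_inv_cancel₀ hA, one_pow, one_mul])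
  by_cases hβ : ∃ i, 2 ≤ i ∧ i ≤ s ∧ β i ≠ 0
  · classical
    obtain ⟨h2, his, hne⟩ := Nat.find_spec hβ
    set i := Nat.find hβ with hi
    -- Rescaling divides β_i by A^(i-1).
    obtain ⟨A, hA⟩ := IsAlgClosed.exists_pow_nat_eq (β i) (show 0 < i - 1 by omega)
    have hA0 : A ≠ 0 := fun h0 => hne (by rw [← hA, h0, zero_pow (by omega)])
    refine ⟨_, _, fun _ => ⟨fun j hj2 hjs hlt hj => ?_, fun hall => ?_⟩, key A hA0⟩
    · have hle : i ≤ j := Nat.find_min' hβ ⟨hj2, hjs, right_ne_zero_of_mul hj⟩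
      have hge : ¬ i < j := fun hij => mul_ne_zero (pow_ne_zero _ (inv_ne_zero hA0)) hne
        (hlt i h2 hij)
      obtain rfl : j = i := by omega
      rw [← hA, ← mul_pow, inv_mul_cancel₀ hA0, one_pow]
    · exact absurd (hall i h2 his) (mul_ne_zero (pow_ne_zero _ (inv_ne_zero hA0)) hne)
  · push Not at hβ
    by_cases hγ : γ = 0
    · exact ⟨β, γ, fun _ => ⟨fun i h2 hi _ hne => absurd (hβ i h2 hi) hne, fun _ hne =>
        absurd hγ hne⟩, ⟨LinearEquiv.refl K _, fun _ _ => rfl⟩⟩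
    · obtain ⟨A, hA⟩ := IsAlgClosed.exists_pow_nat_eq γ (show 0 < s by omega)
      have hA0 : A ≠ 0 := fun h0 => hγ (by rw [← hA, h0, zero_pow (by omega)])
      refine ⟨_, _, fun _ => ⟨fun i h2 hi _ hne => ?_, fun _ _ => ?_⟩, key A hA0⟩
      · exact absurd (hβ i h2 hi) (right_ne_zero_of_mul hne)
      · rw [← hA, ← mul_pow, inv_mul_cancel₀ hA0, one_pow]

/-- Rescaling x turns the nonzero eigenvalue into -1. The inequality in the first alternative serves
the application with exchanged chains: there it rules out the diagonal family. -/
theorem HasChains.isomorphic_of_ne_zero [CharZero K] {μ : Product K R} [FiniteDimensional K R]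
    {k s : ℕ} {e f : ℕ → R} {c d : ℕ → R →ₗ[K] K} {ξ : R →ₗ[K] K}
    (h : HasChains μ k s e f c d ξ) (hfr : Module.finrank K R = k + s + 1) {x : R} (hx : ξ x ≠ 0)
    (ha : c 0 (μ (e 0) x) ≠ 0) :
    (d 0 (μ (f 0) x) ≠ 0 ∧ ∃ α : K, α ≠ 0 ∧ Isomorphic μ (RDiag k s α)) ∨
    (∃ (β : ℕ → K) (γ : K), (IsAlgClosed K → FirstNonzeroIsOne s β γ) ∧
      Isomorphic μ (RNil k s β γ)) := by
  set r := -(c 0 (μ (e 0) x))⁻¹ with hr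
  have hx' : ξ (r • x) ≠ 0 := by
    rw [map_smul, smul_eq_mul]
    exact mul_ne_zero (neg_ne_zero.mpr (inv_ne_zero ha)) hx
  have ha' : c 0 (μ (e 0) (r • x)) = -1 := by
    rw [map_smul, map_smul, smul_eq_mul, hr, neg_mul, inv_mul_cancel₀ ha]
  rw [← finrank_idx (K := K)] at hfr
  by_cases hd : d 0 (μ (f 0) (r • x)) = 0
  · right
    obtain ⟨β, γ, hβ⟩ := h.isomorphic_RNil hfr hx' ha' hd
    obtain ⟨β', γ', h1, h2⟩ := exists_firstNonzeroIsOne h.two_le_k h.two_le_s β γ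
    exact ⟨β', γ', h1, hβ.trans h2⟩
  · left
    refine ⟨fun h0 => hd (by rw [map_smul, map_smul, h0, smul_zero]), ?_⟩
    exact ⟨_, neg_ne_zero.mpr hd, h.isomorphic_RDiag hfr hx' (neg_ne_zero.mpr hd) ha'
      (neg_neg _).symm⟩

end Classification

end

end LeibnizAlg

theorem theorem3p7 {K : Type*} [Field K] [CharZero K] (k s : ℕ) (hk : 2 ≤ k) (hs : 2 ≤ s) :
    -- every algebra of the class is isomorphic to a member of the list
    (∀ {R : Type*} [AddCommGroup R] [Module K R] (μ : LeibnizAlg.Product K R)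
        (N Q : Submodule K R),
      LeibnizAlg.IsLeibniz μ → LeibnizAlg.IsSolvableAlg μ → LeibnizAlg.IsNilradical μ N →
      LeibnizAlg.SubIsomorphic μ N
        (LeibnizAlg.directSum (LeibnizAlg.NF K k) (LeibnizAlg.NF K s)) →
      IsCompl N Q → Module.finrank K Q = 1 →
      (∃ α : K, α ≠ 0 ∧ LeibnizAlg.Isomorphic μ (LeibnizAlg.RDiag k s α)) ∨
      (∃ (β : ℕ → K) (γ : K), (IsAlgClosed K → LeibnizAlg.FirstNonzeroIsOne s β γ) ∧
        LeibnizAlg.Isomorphic μ (LeibnizAlg.RNil k s β γ)) ∨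
      (∃ (β : ℕ → K) (γ : K), (IsAlgClosed K → LeibnizAlg.FirstNonzeroIsOne k β γ) ∧
        LeibnizAlg.Isomorphic μ (LeibnizAlg.RNil s k β γ))) ∧
    -- no isomorphisms between different types
    (∀ α : K, α ≠ 0 → ∀ (β : ℕ → K) (γ : K),
      ¬ LeibnizAlg.Isomorphic (LeibnizAlg.RDiag k s α) (LeibnizAlg.RNil k s β γ) ∧
      ¬ LeibnizAlg.Isomorphic (LeibnizAlg.RDiag k s α) (LeibnizAlg.RNil s k β γ)) ∧
    (k ≠ s → ∀ (β β' : ℕ → K) (γ γ' : K),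
      ¬ LeibnizAlg.Isomorphic (LeibnizAlg.RNil k s β γ) (LeibnizAlg.RNil s k β' γ')) ∧
    -- isomorphisms inside each of the families
    (∀ α α' : K, α ≠ 0 → α' ≠ 0 →
      (LeibnizAlg.Isomorphic (LeibnizAlg.RDiag k s α) (LeibnizAlg.RDiag k s α') ↔
        α = α' ∨ (k = s ∧ α * α' = 1))) ∧
    (∀ (β β' : ℕ → K) (γ γ' : K),
      (LeibnizAlg.Isomorphic (LeibnizAlg.RNil k s β γ) (LeibnizAlg.RNil k s β' γ') ↔
        ∃ A : K, A ≠ 0 ∧ (∀ i : ℕ, 2 ≤ i → i ≤ s → β i = A ^ (i - 1) * β' i) ∧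
          γ = A ^ s * γ')) ∧
    (∀ (β β' : ℕ → K) (γ γ' : K),
      (LeibnizAlg.Isomorphic (LeibnizAlg.RNil s k β γ) (LeibnizAlg.RNil s k β' γ') ↔
        ∃ A : K, A ≠ 0 ∧ (∀ i : ℕ, 2 ≤ i → i ≤ k → β i = A ^ (i - 1) * β' i) ∧
          γ = A ^ k * γ')) := by
  have hRNil : ∀ {k s : ℕ}, 2 ≤ k → 2 ≤ s → ∀ (β β' : ℕ → K) (γ γ' : K),
      (LeibnizAlg.Isomorphic (LeibnizAlg.RNil k s β γ) (LeibnizAlg.RNil k s β' γ') ↔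
        ∃ A : K, A ≠ 0 ∧ (∀ i : ℕ, 2 ≤ i → i ≤ s → β i = A ^ (i - 1) * β' i) ∧
          γ = A ^ s * γ') := fun hk hs β β' γ γ' =>
    ⟨fun h => (LeibnizAlg.of_isomorphic_RNil hk hs hk hs h).2 rfl,
      fun ⟨_, hA, hβ, hγ⟩ => LeibnizAlg.RNil_rescale hk hs hA hβ hγ⟩
  refine ⟨?_, fun α hα β γ => ⟨LeibnizAlg.not_isomorphic_RDiag_RNil hk hs hk hs hα β γ,
    LeibnizAlg.not_isomorphic_RDiag_RNil hk hs hs hk hα β γ⟩, fun hne β β' γ γ' h => ?_,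
    fun α α' hα _ => ⟨LeibnizAlg.eq_or_of_isomorphic_RDiag hk hs hα, ?_⟩, hRNil hk hs,
    hRNil hs hk⟩
  · intro R _ _ μ N Q hμ _ hN hiso hNQ hQ
    obtain ⟨hR, hfr⟩ := LeibnizAlg.finiteDimensional_and_finrank hiso hNQ hQ
    obtain ⟨e, f, c, d, ξ, h, hξ⟩ := LeibnizAlg.exists_hasChains hk hs hμ hN.1 hiso hNQ hQ
    obtain ⟨x, hx⟩ : ∃ x, ξ x ≠ 0 := by
      by_contra! h0
      exact hξ (LinearMap.ext h0)
    by_cases ha : c 0 (μ (e 0) x) = 0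
    · by_cases hd : d 0 (μ (f 0) x) = 0
      -- The whole algebra would be a nilpotent ideal, leaving no room for `Q`.
      · have htop := hN.2.2 ⊤ (fun _ _ _ => ⟨Submodule.mem_top, Submodule.mem_top⟩)
          (h.isNilpotentSub_top hx ha hd)
        have hbot : Q = ⊥ := by simpa [top_le_iff.mp htop] using hNQ.inf_eq_bot
        rw [hbot, finrank_bot] at hQ
        omega
      · rcases h.swap.isomorphic_of_ne_zero (by omega) hx hd with ⟨hne, -⟩ | h'
        · exact absurd ha hne
        · exact Or.inr (Or.inr h')
    · exact (h.isomorphic_of_ne_zero hfr hx ha).imp And.right Or.inl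
  · exact hne (le_antisymm (LeibnizAlg.of_isomorphic_RNil hk hs hs hk h).1
      (LeibnizAlg.of_isomorphic_RNil hs hk hk hs h.symm).1)
  · rintro (rfl | ⟨rfl, hαα⟩)
    · exact ⟨LinearEquiv.refl K _, fun _ _ => rfl⟩
    · exact LeibnizAlg.RDiag_swap hk hαα
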